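/- Let $V_0\subset\mathbb R^3$ be open with boundary $\Sigma_0=\partial V_0$ a $C^2$ hypersurface ($V_0$ lying on one side of it), let $\boldsymbol n$ be its outward unit normal and $\mathcal I_S=\mathcal I-\boldsymbol n\boldsymbol n$. For a vector field $\boldsymbol w$ on $\Sigma_0$ put $$\boldsymbol\nabla_S\cdot\boldsymbol w=\sum_i \boldsymbol e_i\cdot\partial_{Sx_i}\boldsymbol w,\qquad \boldsymbol D_S\cdot\boldsymbol w=\sum_i \boldsymbol e_i\cdot\partial_{Sx_i}(\mathcal I_S\cdot\boldsymbol w)=\boldsymbol\nabla_S\cdot(\mathcal I_S\cdot\boldsymbol w),$$ where $\partial_{Sx_i}$ is the derivative along $\Sigma_0$ in the tangential direction $\mathcal I_S\cdot\boldsymbol e_i$. Let $\boldsymbol\rho=\boldsymbol\rho_\varepsilon:\mathbb R^3\to\mathbb R^3$ ($\varepsilon>0$ small) be $C^1$ displacement fields with $|\boldsymbol\rho_\varepsilon|\le C\varepsilon$ and $\|D\boldsymbol\rho_\varepsilon\|\le C\varepsilon$ on $\mathbb R^3$, with $C$ independent of $\varepsilon$; for example $\boldsymbol\rho_\varepsilon=\varepsilon\boldsymbol\rho_1$.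 Let $V_\varepsilon=\{\boldsymbol x+\boldsymbol\rho_\varepsilon(\boldsymbol x):\boldsymbol x\in V_0\}$ be the perturbed domain, $\Sigma_\varepsilon=\partial V_\varepsilon$ its boundary and $\boldsymbol n_\varepsilon$ its outward unit normal. Let $W$ be an open neighbourhood of $\Sigma_0$, $c\in\mathbb R$, $\gamma\in C^1(W)$, and let $\sigma=\sigma(\boldsymbol x,\phi)$ be continuous on $W\times\mathbb R$. For small $\varepsilon$ let $\phi=\phi_\varepsilon$ be $C^2$ on $W\cup V_\varepsilon$ and satisfy $$\boldsymbol\nabla\cdot\boldsymbol\nabla\phi=\sigma(\boldsymbol x,\phi)\quad\text{in }V_\varepsilon .$$ Assume that near each point of $\Sigma_0$ the derivatives of $\phi_\varepsilon$ of order at most $2$ are bounded uniformly in small $\varepsilon$, and that the second derivatives are equicontinuous at each point of $\Sigma_0$, uniformly in small $\varepsilon$. Below, an equation on $\Sigma_0$ "holds to first order" if its two sides differ by $o(\varepsilon)$ as $\varepsilon\to0^+$, uniformly on every compact subset of $\Sigma_0$. (a) If the Robin condition $\boldsymbol n_\varepsilon\cdot\boldsymbol\nabla\phi=c\phi+\gamma$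 holds on $\Sigma_\varepsilon$ for all small $\varepsilon$, then to first order $$\boldsymbol n\cdot\boldsymbol\nabla\phi+\boldsymbol D_S\cdot\big(\boldsymbol\rho\,\boldsymbol n\cdot\boldsymbol\nabla\phi-\boldsymbol\rho\cdot\boldsymbol n\,\boldsymbol\nabla\phi\big)+\sigma\,\boldsymbol\rho\cdot\boldsymbol n=(c\phi+\gamma)+\boldsymbol\nabla_S\cdot[\boldsymbol\rho(c\phi+\gamma)]+(\boldsymbol\rho\cdot\boldsymbol n)\,\boldsymbol n\cdot\boldsymbol\nabla(c\phi+\gamma)\quad\text{on }\Sigma_0. \tag{1}$$ (b) More precisely, for every compact $K\subset\Sigma_0$, the two sides of the Robin condition at the displaced points $\boldsymbol x+\boldsymbol\rho_\varepsilon(\boldsymbol x)$ differ by $o(\varepsilon)$ uniformly for $\boldsymbol x\in K$ if and only if the two sides of (1) differ by $o(\varepsilon)$ uniformly on $K$. (c) If the displacement is normal, $\boldsymbol\rho_\varepsilon=\rho\,\boldsymbol n$ on $\Sigma_0$ with scalar functions $\rho=\rho_\varepsilon$, then (a) and (b) hold with (1) replaced by $$\boldsymbol n\cdot\boldsymbol\nabla\phi-\boldsymbol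 D_S\cdot(\rho\,\boldsymbol\nabla\phi)+\rho\,\sigma=\big[1+\rho\,(\boldsymbol\nabla_S\cdot\boldsymbol n)+\rho\,\boldsymbol n\cdot\boldsymbol\nabla\big](c\phi+\gamma)\quad\text{on }\Sigma_0 .$$ -/

import Mathlib

open Filter Topology
open scoped InnerProductSpace Gradient

noncomputable section

/-- Euclidean three-space. -/
abbrev E3 : Type := EuclideanSpace ℝ (Fin 3)

/-- The laboratory frame. -/
def labFrame (i : Fin 3) : E3 := EuclideanSpace.single i (1 : ℝ)

/-- `g` is a defining function of class `C^k` for the set `V` near the boundary point `x`: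
near `x` the set `V` is `{g < 0}`, and the gradient of `g` does not vanish at `x`. -/
structure IsLocalDefiningFunction (k : ℕ) (V : Set E3) (x : E3) (g : E3 → ℝ) : Prop where
  contDiffAt : ContDiffAt ℝ k g x
  eq_zero : g x = 0
  gradient_ne_zero : ∇ g x ≠ 0
  mem_iff : ∀ᶠ y in 𝓝 x, (y ∈ V ↔ g y < 0)

/-- The boundary of `V` is a hypersurface of class `C^2`, with `V` on one side of it. -/
def HasC2Boundary (V : Set E3) : Prop :=
  ∀ x ∈ frontier V, ∃ g : E3 → ℝ, IsLocalDefiningFunction 2 V x g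

/-- `ν` is the outward unit normal of `V` at its boundary point `x`. -/
def IsOutwardUnitNormal (V : Set E3) (x ν : E3) : Prop :=
  ∃ g : E3 → ℝ, IsLocalDefiningFunction 1 V x g ∧ ν = (‖∇ g x‖)⁻¹ • ∇ g x

open Classical in
/-- The outward unit normal field `n` of `V`
(it is unique where it exists; the value is `0` where there is none). -/
def outwardNormal (V : Set E3) (x : E3) : E3 :=
  if h : ∃ ν : E3, IsOutwardUnitNormal V x ν then h.choose else 0

/-- The action `I_S · v = v - n (n · v)` of the boundary identity tensor
of the surface `S = ∂V` at `x`. -/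
def tangentialProj (V : Set E3) (x v : E3) : E3 :=
  v - ⟪outwardNormal V x, v⟫_ℝ • outwardNormal V x

/-- The boundary directional derivative `∂_{S x_i} w`, the derivative of `w` at `x`, along the
surface `S = ∂V`, in the tangential direction `I_S · e_i`. Only the values of `w` on `S` enter, so
it makes sense for quantities that live on `S` only, such as the normal. -/
def surfPartial (V : Set E3) (i : Fin 3) (w : E3 → E3) (x : E3) : E3 :=
  fderivWithin ℝ w (frontier V) x (tangentialProj V x (labFrame i))

/-- The boundary divergence `∇_S · w = ∑ i, e_i · ∂_{S x_i} w` on `S = ∂V`. -/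
def surfDiv (V : Set E3) (w : E3 → E3) (x : E3) : ℝ :=
  ∑ i : Fin 3, ⟪labFrame i, surfPartial V i w x⟫_ℝ

/-- The divergence `D_S · w = ∑ i, e_i · ∂_{S x_i} (I_S · w)` formed with the boundary exterior
differential operator `D_S` of `S = ∂V`. -/
def extSurfDiv (V : Set E3) (w : E3 → E3) (x : E3) : ℝ :=
  ∑ i : Fin 3, ⟪labFrame i, surfPartial V i (fun y => tangentialProj V y (w y)) x⟫_ℝ

/-- The displacement map `x ↦ x + ρ(x)`. -/
def displace (ρ : E3 → E3) (x : E3) : E3 := x + ρ x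

/-- The perturbed domain, obtained from `V` by the displacement `ρ`. -/
def perturbedDomain (V : Set E3) (ρ : E3 → E3) : Set E3 := displace ρ '' V

/-- Left-hand side of the transferred condition:
`n·∇φ + D_S·(ρ n·∇φ - ρ·n ∇φ) + s ρ·n`, where `s` is the source term. -/
def transferredFlux (V : Set E3) (ρ : E3 → E3) (φ s : E3 → ℝ) (x : E3) : ℝ :=
  ⟪outwardNormal V x, ∇ φ x⟫_ℝ
    + extSurfDiv V (fun y => ⟪outwardNormal V y, ∇ φ y⟫_ℝ • ρ y
        - ⟪ρ y, outwardNormal V y⟫_ℝ • ∇ φ y) x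
    + s x * ⟪ρ x, outwardNormal V x⟫_ℝ

/-- Right-hand side of the transferred condition:
`f + ∇_S·[ρ f] + (ρ·n) n·∇f`, where `f` is the right-hand side of the original condition. -/
def transferredData (V : Set E3) (ρ : E3 → E3) (f : E3 → ℝ) (x : E3) : ℝ :=
  f x + surfDiv V (fun y => f y • ρ y) x
    + ⟪ρ x, outwardNormal V x⟫_ℝ * ⟪outwardNormal V x, ∇ f x⟫_ℝ

/-- Left-hand side of the transferred condition for a normal displacement `h n`:
`n·∇φ - D_S·(h ∇φ) + h s`. -/
def transferredFluxNormal (V : Set E3) (h : E3 → ℝ) (φ s : E3 → ℝ) (x : E3) : ℝ :=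
  ⟪outwardNormal V x, ∇ φ x⟫_ℝ - extSurfDiv V (fun y => h y • ∇ φ y) x + h x * s x

/-- Right-hand side of the transferred condition for a normal displacement `h n`:
`[1 + h (∇_S·n) + h n·∇] f`. -/
def transferredDataNormal (V : Set E3) (h : E3 → ℝ) (f : E3 → ℝ) (x : E3) : ℝ :=
  f x + h x * surfDiv V (outwardNormal V) x * f x + h x * ⟪outwardNormal V x, ∇ f x⟫_ℝ

/-- `A ε = B ε` on `K` up to first order in `ε`: the difference is `o(ε)` as `ε → 0+`,
uniformly on `K`. -/
def EqToFirstOrder (K : Set E3) (A B : ℝ → E3 → ℝ) : Prop :=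
  ∀ η > 0, ∀ᶠ ε in 𝓝[>] (0 : ℝ), ∀ x ∈ K, |A ε x - B ε x| ≤ η * ε

/-- The family `φ ε` is, for small `ε > 0`, bounded in `C^2` near every point of `S`, and its
second derivatives are equicontinuous at every point of `S`, both uniformly in `ε`. -/
def IsC2Controlled (S : Set E3) (φ : ℝ → E3 → ℝ) : Prop :=
  ∀ x ∈ S,
    (∀ k ≤ 2, ∃ C : ℝ, ∀ᶠ p : ℝ × E3 in 𝓝[>] (0 : ℝ) ×ˢ 𝓝 x,
      ‖iteratedFDeriv ℝ k (φ p.1) p.2‖ ≤ C) ∧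
    (∀ η > 0, ∀ᶠ p : ℝ × E3 in 𝓝[>] (0 : ℝ) ×ˢ 𝓝 x,
      ‖iteratedFDeriv ℝ 2 (φ p.1) p.2 - iteratedFDeriv ℝ 2 (φ p.1) x‖ ≤ η)

end

/-!
The displacement map `T = 1 + ρ` is, for small `ε`, a `C^1` diffeomorphism, so it carries the boundary
`S` onto the boundary of the perturbed domain, and the normals `n` at `x` and `ν` at `T x` satisfy
`(1 + R)ᵀ ν = l n` with `R = Dρ(x)` and `l > 0`
(`exists_inner_outwardNormal_perturbedDomain`). Hence `ν = n + (n·R n) n - Rᵀ n + O(ε²)`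
(`abs_inner_sub_le`). Together with the Taylor expansion of `∇φ` along the displacement `r = ρ(x)`,
with `G = ∇φ(x)` and `H` the Hessian of `φ` at `x`, this gives
`ν·∇φ(T x) = n·G + n·H r - n·R G + (n·G)(n·R n) + o(ε)` (`isLittleO_normalDeriv`).

On the other side, the field `ρ n·∇φ - ρ·n ∇φ` is tangential, so its `D_S` divergence is its surface
divergence. That divergence is computed with an ambient `C^1` extension of the normal, the normalized
gradient of a defining function; this is legitimate because the derivative within `S` is determined
on the tangent cone, which contains every direction orthogonal to `n` by the implicit function
theorem (`IsLocalDefiningFunction.surfPartial_eq`). The terms in the derivative of the normal cancel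
since the second fundamental form is symmetric, and what is left is exactly
`n·H r - n·R G + (n·G)(n·R n) + (n·G) τ - Δφ (r·n)`, where `τ = ∇_S·ρ`
(`transferredFlux_eq`). Similarly the right-hand side of the transferred condition is
`f + Df r + f τ` (`transferredData_eq`).

The Poisson equation extends by continuity to the perturbed boundary, and equicontinuity of the second
derivatives gives `Δφ = σ + o(1)` on `S` (`isLittleO_source_sub_laplacian`). So the two sides of the
transferred condition differ by `1 + τ` times the difference of the two sides of the displaced Robin
condition, up to `o(ε)` (`isLittleO_transferred_sub_displaced`). As `τ = O(ε)`, one difference is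
`o(ε)` if and only if the other one is. For a normal displacement the two forms of the transferred
condition agree exactly (`transferredFluxNormal_eq`, `transferredDataNormal_eq`).

All estimates are made near a single boundary point and made uniform on compact sets at the end.
-/

open Asymptotics

/-! ### Local defining functions and the outward normal -/

lemma inner_gradient_left_E3 (f : E3 → ℝ) (x v : E3) : ⟪∇ f x, v⟫_ℝ = fderiv ℝ f x v :=
  inner_gradient_left ..

/-- Moving from a zero of `g` in a direction of descent makes `g` negative. -/
lemma eventually_neg_of_fderiv_neg {g : E3 → ℝ} {x v : E3} (hg : DifferentiableAt ℝ g x)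
    (h0 : g x = 0) (hv : fderiv ℝ g x v < 0) : ∀ᶠ t : ℝ in 𝓝[>] 0, g (x + t • v) < 0 := by
  have h1 : HasDerivAt (fun t : ℝ => g (x + t • v)) (fderiv ℝ g x v) 0 := by
    have h2 : HasDerivAt (fun t : ℝ => x + t • v) v 0 := by
      simpa using ((hasDerivAt_id (0 : ℝ)).smul_const v).const_add x
    have h3 : HasFDerivAt g (fderiv ℝ g x) (x + (0 : ℝ) • v) := by simpa using hg.hasFDerivAt
    exact h3.comp_hasDerivAt (0 : ℝ) h2
  have h2 := (hasDerivAt_iff_tendsto_slope.1 h1).mono_left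
    (nhdsWithin_mono (0 : ℝ) (s := Set.Ioi 0) (fun t (ht : 0 < t) => ht.ne'))
  filter_upwards [h2.eventually (gt_mem_nhds hv), self_mem_nhdsWithin] with t ht (ht0 : 0 < t)
  rw [slope_def_field] at ht
  simp only [zero_smul, add_zero, h0, sub_zero] at ht
  rcases div_neg_iff.1 ht with h | h
  · exact absurd h.2 (not_lt.2 ht0.le)
  · exact h.1

lemma continuousAt_gradient {f : E3 → ℝ} {x : E3} (hf : ContDiffAt ℝ 1 f x) :
    ContinuousAt (∇ f) x := by
  have h1 : ContinuousAt (fderiv ℝ f) x := (hf.fderiv_right (m := 0) (by norm_num)).continuousAt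
  exact (InnerProductSpace.toDual ℝ E3).symm.continuous.continuousAt.comp h1

namespace IsLocalDefiningFunction

variable {k l : ℕ} {V : Set E3} {x : E3} {g h : E3 → ℝ}

lemma differentiableAt (hg : IsLocalDefiningFunction k V x g) (hk : 1 ≤ k) :
    DifferentiableAt ℝ g x :=
  hg.contDiffAt.differentiableAt (by exact_mod_cast (by omega : k ≠ 0))

lemma of_le (hg : IsLocalDefiningFunction k V x g) (hlk : l ≤ k) :
    IsLocalDefiningFunction l V x g :=
  ⟨hg.contDiffAt.of_le (by exact_mod_cast hlk), hg.eq_zero, hg.gradient_ne_zero, hg.mem_iff⟩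

/-- The gradients of two defining functions of a set have the same direction: a direction in which
one of them decreases points into the set, so the other one cannot increase. If the normalized
gradients `u ≠ w` were different, the direction `w - u` would contradict this. -/
lemma unitGradient_eq (hg : IsLocalDefiningFunction k V x g) (hk : 1 ≤ k)
    (hh : IsLocalDefiningFunction l V x h) (hl : 1 ≤ l) :
    (‖∇ g x‖)⁻¹ • ∇ g x = (‖∇ h x‖)⁻¹ • ∇ h x := by
  have key : ∀ v, ⟪∇ g x, v⟫_ℝ < 0 → ⟪∇ h x, v⟫_ℝ ≤ 0 := by
    intro v hv
    by_contra! hv'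
    have hdg := hg.differentiableAt hk
    have hdh := hh.differentiableAt hl
    rw [inner_gradient_left_E3] at hv hv'
    have h1 := eventually_neg_of_fderiv_neg hdg hg.eq_zero hv
    have hfd : fderiv ℝ (-h) x v < 0 := by
      rw [fderiv_neg]; simpa using hv'
    have h2 := eventually_neg_of_fderiv_neg (g := -h) hdh.neg (by simp [hh.eq_zero]) hfd
    have h3 : Tendsto (fun t : ℝ => x + t • v) (𝓝[>] 0) (𝓝 x) := by
      have : Continuous fun t : ℝ => x + t • v := by fun_prop
      simpa using (this.tendsto 0).mono_left nhdsWithin_le_nhds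
    obtain ⟨t, ht1, ht2, ht3, ht4⟩ := (h1.and (h2.and ((h3.eventually hg.mem_iff).and
      (h3.eventually hh.mem_iff)))).exists
    have := ht4.1 (ht3.2 ht1)
    simp only [Pi.neg_apply] at ht2
    linarith
  have hgn : 0 < ‖∇ g x‖ := norm_pos_iff.2 hg.gradient_ne_zero
  have hhn : 0 < ‖∇ h x‖ := norm_pos_iff.2 hh.gradient_ne_zero
  set u := (‖∇ g x‖)⁻¹ • ∇ g x with hu
  set w := (‖∇ h x‖)⁻¹ • ∇ h x with hw
  have hun : ‖u‖ = 1 := by rw [hu, norm_smul]; simp [hgn.ne']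
  have hwn : ‖w‖ = 1 := by rw [hw, norm_smul]; simp [hhn.ne']
  have hgu : ∇ g x = ‖∇ g x‖ • u := by rw [hu, smul_smul]; simp [hgn.ne']
  have hhw : ∇ h x = ‖∇ h x‖ • w := by rw [hw, smul_smul]; simp [hhn.ne']
  by_contra hne
  have hlt : ⟪u, w⟫_ℝ < 1 := by
    rcases (real_inner_le_norm u w).lt_or_eq with h | h
    · simpa [hun, hwn] using h
    · rw [hun, hwn, mul_one] at h
      exact absurd ((inner_eq_one_iff_of_norm_eq_one hun hwn).1 h) hne
  have h1 := key (w - u) (by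
    rw [hgu, real_inner_smul_left, inner_sub_right, real_inner_self_eq_norm_sq, hun]
    exact mul_neg_of_pos_of_neg hgn (by linarith))
  rw [hhw, real_inner_smul_left, inner_sub_right, real_inner_self_eq_norm_sq, hwn,
    real_inner_comm] at h1
  nlinarith

lemma outwardNormal_eq (hg : IsLocalDefiningFunction k V x g) (hk : 1 ≤ k) :
    outwardNormal V x = (‖∇ g x‖)⁻¹ • ∇ g x := by
  have hex : ∃ ν : E3, IsOutwardUnitNormal V x ν := ⟨_, g, hg.of_le hk, rfl⟩
  rw [outwardNormal, dif_pos hex]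
  obtain ⟨g', hg', h'⟩ := hex.choose_spec
  rw [h']
  exact hg'.unitGradient_eq le_rfl hg hk

lemma norm_outwardNormal (hg : IsLocalDefiningFunction k V x g) (hk : 1 ≤ k) :
    ‖outwardNormal V x‖ = 1 := by
  rw [hg.outwardNormal_eq hk, norm_smul]
  simp [hg.gradient_ne_zero]

lemma gradient_eq_smul (hg : IsLocalDefiningFunction k V x g) (hk : 1 ≤ k) :
    ∇ g x = ‖∇ g x‖ • outwardNormal V x := by
  rw [hg.outwardNormal_eq hk, smul_smul]
  simp [hg.gradient_ne_zero]

/-- Near a boundary point the boundary is the zero set of a defining function. -/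
lemma eventually_mem_frontier_iff (hg : IsLocalDefiningFunction k V x g) (hk : 1 ≤ k)
    (hV : IsOpen V) : ∀ᶠ y in 𝓝 x, (y ∈ frontier V ↔ g y = 0) := by
  have hk' : (1 : WithTop ℕ∞) ≤ (k : ℕ∞) := by exact_mod_cast hk
  have hC1 : ContDiffAt ℝ 1 g x := hg.contDiffAt.of_le hk'
  filter_upwards [hg.mem_iff.eventually_nhds, hg.mem_iff,
    (hC1.eventually (by simp)),
    (continuousAt_gradient hC1).eventually_ne hg.gradient_ne_zero] with y hy hy' hc hn
  have hcont : ContinuousAt g y := hc.continuousAt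
  rw [frontier, hV.interior_eq]
  constructor
  · rintro ⟨hcl, hnot⟩
    refine le_antisymm ?_ (not_lt.1 fun h => hnot (hy'.2 h))
    by_contra! hpos
    have h1 := (hcont.eventually (lt_mem_nhds hpos)).and hy
    obtain ⟨z, hz3, hz1, hz2⟩ := ((mem_closure_iff_frequently.1 hcl).and_eventually h1).exists
    exact absurd (hz2.1 hz3) (not_lt.2 hz1.le)
  · intro h0
    refine ⟨?_, fun h => absurd (hy'.1 h) (by simp [h0])⟩
    have hv : fderiv ℝ g y (-∇ g y) < 0 := by
      rw [← inner_gradient_left_E3, inner_neg_right, real_inner_self_eq_norm_sq]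
      have := norm_pos_iff.2 hn
      nlinarith
    have h1 := eventually_neg_of_fderiv_neg (hc.differentiableAt (by simp)) h0 hv
    have h3 : Tendsto (fun t : ℝ => y + t • (-∇ g y)) (𝓝[>] 0) (𝓝 y) := by
      have : Continuous fun t : ℝ => y + t • (-∇ g y) := by fun_prop
      simpa using (this.tendsto 0).mono_left nhdsWithin_le_nhds
    refine mem_closure_of_tendsto h3 ?_
    filter_upwards [h1, h3.eventually hy] with t ht ht'
    exact ht'.2 ht

/-- A defining function at a boundary point is one at the nearby boundary points. -/
lemma eventually_of_mem_frontier (hg : IsLocalDefiningFunction k V x g) (hk : 1 ≤ k)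
    (hV : IsOpen V) : ∀ᶠ y in 𝓝[frontier V] x, IsLocalDefiningFunction k V y g := by
  have hk' : (1 : WithTop ℕ∞) ≤ (k : ℕ∞) := by exact_mod_cast hk
  have hC1 : ContDiffAt ℝ 1 g x := hg.contDiffAt.of_le hk'
  filter_upwards [self_mem_nhdsWithin,
    nhdsWithin_le_nhds (hg.eventually_mem_frontier_iff hk hV),
    nhdsWithin_le_nhds hg.mem_iff.eventually_nhds,
    nhdsWithin_le_nhds (hg.contDiffAt.eventually (by simp)),
    nhdsWithin_le_nhds ((continuousAt_gradient hC1).eventually_ne hg.gradient_ne_zero)]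
    with y hyS hy hy' hc hn
  exact ⟨hc, hy.1 hyS, hn, hy'⟩

/-- Every direction orthogonal to the normal is tangent to the boundary, by the implicit function
theorem. -/
lemma mem_tangentConeAt (hg : IsLocalDefiningFunction k V x g) (hk : 1 ≤ k) (hV : IsOpen V)
    {v : E3} (hv : ⟪outwardNormal V x, v⟫_ℝ = 0) : v ∈ tangentConeAt ℝ (frontier V) x := by
  have hk' : (1 : WithTop ℕ∞) ≤ (k : ℕ∞) := by exact_mod_cast hk
  have hC1 : ContDiffAt ℝ 1 g x := hg.contDiffAt.of_le hk'
  have hs : HasStrictFDerivAt g (fderiv ℝ g x) x := hC1.hasStrictFDerivAt (by simp)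
  have hsurj : (fderiv ℝ g x).range = ⊤ := by
    rw [LinearMap.range_eq_top]
    apply LinearMap.surjective
    intro h0
    apply hg.gradient_ne_zero
    rw [← inner_self_eq_zero (𝕜 := ℝ), inner_gradient_left_E3]
    exact congrArg (fun f : E3 →ₗ[ℝ] ℝ => f (∇ g x)) h0
  have hvk : v ∈ (fderiv ℝ g x).ker := by
    rw [LinearMap.mem_ker]
    change fderiv ℝ g x v = 0
    rw [← inner_gradient_left_E3, hg.gradient_eq_smul hk, real_inner_smul_left, hv, mul_zero]
  set G := hs.implicitFunction g (fderiv ℝ g x) hsurj (g x) with hG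
  have hGd : HasStrictFDerivAt G (fderiv ℝ g x).ker.subtypeL 0 := hs.to_implicitFunction hsurj
  have hG0 : G 0 = x := hs.implicitFunction_apply_image hsurj
  have hmap : ∀ᶠ z in 𝓝 (0 : (fderiv ℝ g x).ker), g (G z) = g x :=
    (hs.map_implicitFunction_eq hsurj).curry_nhds.self_of_nhds
  have hev : ∀ᶠ z in 𝓝 (0 : (fderiv ℝ g x).ker), G z ∈ frontier V := by
    have hc : Tendsto G (𝓝 0) (𝓝 x) := by
      simpa [hG0] using hGd.hasFDerivAt.continuousAt.tendsto
    filter_upwards [hmap, hc.eventually (hg.eventually_mem_frontier_iff hk hV)] with z hz hz'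
    rw [hz', hz, hg.eq_zero]
  have hT : v ∈ tangentConeAt ℝ (G '' {z | G z ∈ frontier V}) (G 0) :=
    (hGd.hasFDerivAt.hasFDerivWithinAt (s := {z | G z ∈ frontier V})).mapsTo_tangent_cone
      (show (⟨v, hvk⟩ : (fderiv ℝ g x).ker) ∈ _ by
        rw [tangentConeAt_of_mem_nhds hev]; trivial)
  rw [hG0] at hT
  refine tangentConeAt_mono ?_ hT
  rintro _ ⟨z, hz, rfl⟩
  exact hz

end IsLocalDefiningFunction

/-! ### Surface derivatives through ambient extensions -/

/-- The tangential projection `I_S` at `x` as a continuous linear map. -/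
noncomputable def tangentialProjL (V : Set E3) (x : E3) : E3 →L[ℝ] E3 :=
  ContinuousLinearMap.id ℝ E3 -
    (innerSL ℝ (outwardNormal V x)).smulRight (outwardNormal V x)

@[simp]
lemma tangentialProjL_apply (V : Set E3) (x v : E3) :
    tangentialProjL V x v = tangentialProj V x v := by
  simp [tangentialProjL, tangentialProj]

lemma tangentialProj_eq_self {V : Set E3} {x v : E3} (hv : ⟪outwardNormal V x, v⟫_ℝ = 0) :
    tangentialProj V x v = v := by
  simp [tangentialProj, hv]

/-- The trace `∑ i, e_i · A (I_S · e_i)` of a linear map `A` over the tangent plane at `x`. -/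
noncomputable def tangentialTrace (V : Set E3) (x : E3) (A : E3 →L[ℝ] E3) : ℝ :=
  ∑ i : Fin 3, ⟪labFrame i, A (tangentialProj V x (labFrame i))⟫_ℝ

lemma sum_inner_labFrame_smul (v : E3) : ∑ i : Fin 3, ⟪labFrame i, v⟫_ℝ • labFrame i = v := by
  simpa [labFrame] using (EuclideanSpace.basisFun (Fin 3) ℝ).sum_repr' v

lemma tangentialTrace_add (V : Set E3) (x : E3) (A B : E3 →L[ℝ] E3) :
    tangentialTrace V x (A + B) = tangentialTrace V x A + tangentialTrace V x B := by
  simp [tangentialTrace, inner_add_right, Finset.sum_add_distrib]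

lemma tangentialTrace_sub (V : Set E3) (x : E3) (A B : E3 →L[ℝ] E3) :
    tangentialTrace V x (A - B) = tangentialTrace V x A - tangentialTrace V x B := by
  simp [tangentialTrace, inner_sub_right, Finset.sum_sub_distrib]

lemma tangentialTrace_neg (V : Set E3) (x : E3) (A : E3 →L[ℝ] E3) :
    tangentialTrace V x (-A) = -tangentialTrace V x A := by
  simp [tangentialTrace]

lemma tangentialTrace_smul (V : Set E3) (x : E3) (c : ℝ) (A : E3 →L[ℝ] E3) :
    tangentialTrace V x (c • A) = c * tangentialTrace V x A := by
  simp only [tangentialTrace, smul_apply, inner_smul_right, Finset.mul_sum]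

lemma tangentialTrace_smulRight (V : Set E3) (x : E3) (ℓ : E3 →L[ℝ] ℝ) (r : E3) :
    tangentialTrace V x (ℓ.smulRight r) = ℓ (tangentialProj V x r) := by
  conv_rhs => rw [← tangentialProjL_apply, ← sum_inner_labFrame_smul r]
  simp only [tangentialTrace, ContinuousLinearMap.smulRight_apply, inner_smul_right, map_sum,
    map_smul, tangentialProjL_apply, smul_eq_mul, mul_comm]

lemma abs_tangentialTrace_le {V : Set E3} {x : E3} (hn : ‖outwardNormal V x‖ = 1)
    (A : E3 →L[ℝ] E3) : |tangentialTrace V x A| ≤ 6 * ‖A‖ := by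
  have hi : ∀ i : Fin 3, ‖labFrame i‖ = 1 := fun i => by simp [labFrame]
  have hp : ∀ i : Fin 3, ‖tangentialProj V x (labFrame i)‖ ≤ 2 := fun i => by
    refine (norm_sub_le _ _).trans ?_
    have := abs_real_inner_le_norm (outwardNormal V x) (labFrame i)
    rw [norm_smul, Real.norm_eq_abs, hn, hi]
    rw [hn, hi] at this
    linarith
  calc |tangentialTrace V x A| ≤ ∑ i : Fin 3, 2 * ‖A‖ := by
        refine (Finset.abs_sum_le_sum_abs _ _).trans (Finset.sum_le_sum fun i _ => ?_)
        refine (abs_real_inner_le_norm _ _).trans ?_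
        rw [hi, one_mul]
        refine (A.le_opNorm _).trans ?_
        nlinarith [hp i, norm_nonneg A]
    _ = 6 * ‖A‖ := by simp; ring

lemma inner_outwardNormal_tangentialProj {V : Set E3} {x : E3} (hn : ‖outwardNormal V x‖ = 1)
    (v : E3) : ⟪outwardNormal V x, tangentialProj V x v⟫_ℝ = 0 := by
  rw [tangentialProj, inner_sub_right, inner_smul_right, real_inner_self_eq_norm_sq, hn]
  ring

namespace IsLocalDefiningFunction

variable {k : ℕ} {V : Set E3} {x : E3} {g : E3 → ℝ}

/-- The derivative along the surface can be computed with any differentiable extension: the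
derivative within `S` is determined on the tangent cone. -/
lemma surfPartial_eq (hg : IsLocalDefiningFunction k V x g) (hk : 1 ≤ k) (hV : IsOpen V)
    (hx : x ∈ frontier V) {w w' : E3 → E3} {A : E3 →L[ℝ] E3} (hA : HasFDerivAt w' A x)
    (hw : w =ᶠ[𝓝[frontier V] x] w') (i : Fin 3) :
    surfPartial V i w x = A (tangentialProj V x (labFrame i)) := by
  have h1 : HasFDerivWithinAt w A (frontier V) x :=
    hA.hasFDerivWithinAt.congr_of_eventuallyEq hw (hw.self_of_nhdsWithin hx)
  exact h1.differentiableWithinAt.hasFDerivWithinAt.unique_on h1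
    (hg.mem_tangentConeAt hk hV
      (inner_outwardNormal_tangentialProj (hg.norm_outwardNormal hk) _))

lemma surfDiv_eq (hg : IsLocalDefiningFunction k V x g) (hk : 1 ≤ k) (hV : IsOpen V)
    (hx : x ∈ frontier V) {w w' : E3 → E3} {A : E3 →L[ℝ] E3} (hA : HasFDerivAt w' A x)
    (hw : w =ᶠ[𝓝[frontier V] x] w') : surfDiv V w x = tangentialTrace V x A := by
  simp only [surfDiv, tangentialTrace, hg.surfPartial_eq hk hV hx hA hw]

end IsLocalDefiningFunction

lemma extSurfDiv_eq_surfDiv (V : Set E3) (w : E3 → E3) (x : E3) :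
    extSurfDiv V w x = surfDiv V (fun y => tangentialProj V y (w y)) x := rfl

/-- `N` extends the unit normal of `V` from the boundary to a neighbourhood of `x`; its derivative
`M` at `x` takes tangential values and is symmetric on the tangent plane. -/
structure IsNormalExtension (V : Set E3) (x : E3) (N : E3 → E3) (M : E3 →L[ℝ] E3) : Prop where
  hasFDerivAt : HasFDerivAt N M x
  eventuallyEq : outwardNormal V =ᶠ[𝓝[frontier V] x] N
  apply_eq : N x = outwardNormal V x
  inner_eq_zero : ∀ v, ⟪outwardNormal V x, M v⟫_ℝ = 0
  symm : ∀ p q, ⟪outwardNormal V x, p⟫_ℝ = 0 → ⟪outwardNormal V x, q⟫_ℝ = 0 →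
    ⟪M p, q⟫_ℝ = ⟪p, M q⟫_ℝ

/-- The derivative of the gradient represents the Hessian. -/
lemma hasFDerivAt_gradient {f : E3 → ℝ} {x : E3} (hf : ContDiffAt ℝ 2 f x) :
    HasFDerivAt (∇ f) (fderiv ℝ (∇ f) x) x ∧
      ∀ v w, ⟪fderiv ℝ (∇ f) x v, w⟫_ℝ = fderiv ℝ (fderiv ℝ f) x v w := by
  have h1 : DifferentiableAt ℝ (fderiv ℝ f) x :=
    (hf.fderiv_right (m := 1) (by norm_num)).differentiableAt (by simp)
  have h2 : DifferentiableAt ℝ (∇ f) x := by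
    have h3 : ∇ f = fun y => ∑ i : Fin 3, fderiv ℝ f y (labFrame i) • labFrame i := by
      funext y
      simp only [← inner_gradient_left_E3, real_inner_comm (labFrame _) (∇ f y)]
      exact (sum_inner_labFrame_smul _).symm
    rw [h3]
    exact DifferentiableAt.fun_sum fun i _ =>
      (h1.clm_apply (differentiableAt_const _)).smul_const _
  refine ⟨h2.hasFDerivAt, fun v w => ?_⟩
  have h4 : HasFDerivAt (fun y => ⟪∇ f y, w⟫_ℝ) _ x := h2.hasFDerivAt.inner ℝ (hasFDerivAt_const w x)
  have h5 : HasFDerivAt (fun y => fderiv ℝ f y w) _ x :=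
    h1.hasFDerivAt.clm_apply (hasFDerivAt_const w x)
  simp only [inner_gradient_left_E3] at h4
  simpa [fderivInnerCLM_apply] using congrArg (fun L : E3 →L[ℝ] ℝ => L v) (h4.unique h5)

lemma inner_fderiv_gradient_comm {f : E3 → ℝ} {x : E3} (hf : ContDiffAt ℝ 2 f x) (v w : E3) :
    ⟪fderiv ℝ (∇ f) x v, w⟫_ℝ = ⟪v, fderiv ℝ (∇ f) x w⟫_ℝ := by
  rw [(hasFDerivAt_gradient hf).2, real_inner_comm, (hasFDerivAt_gradient hf).2]
  exact (hf.isSymmSndFDerivAt (by simp)).eq v w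

/-- The normalized gradient of a `C^2` defining function extends the unit normal. -/
lemma IsLocalDefiningFunction.exists_isNormalExtension {V : Set E3} {x : E3} {g : E3 → ℝ}
    (hg : IsLocalDefiningFunction 2 V x g) (hV : IsOpen V) :
    ∃ N M, IsNormalExtension V x N M := by
  have hg2 : ContDiffAt ℝ 2 g x := hg.contDiffAt
  have hgn : ‖∇ g x‖ ≠ 0 := norm_ne_zero_iff.2 hg.gradient_ne_zero
  obtain ⟨hH, -⟩ := hasFDerivAt_gradient hg2
  set H := fderiv ℝ (∇ g) x with hHdef
  have hdn : DifferentiableAt ℝ (fun y => (‖∇ g y‖)⁻¹) x :=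
    (hH.differentiableAt.norm ℝ hg.gradient_ne_zero).inv hgn
  set b := fderiv ℝ (fun y => (‖∇ g y‖)⁻¹) x
  have hN : HasFDerivAt (fun y => (‖∇ g y‖)⁻¹ • ∇ g y)
      ((‖∇ g x‖)⁻¹ • H + b.smulRight (∇ g x)) x := hdn.hasFDerivAt.smul hH
  have hcont : ∀ᶠ y in 𝓝 x, ∇ g y ≠ 0 := hH.continuousAt.eventually_ne hg.gradient_ne_zero
  have hNx : (‖∇ g x‖)⁻¹ • ∇ g x = outwardNormal V x := (hg.outwardNormal_eq (by norm_num)).symm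
  refine ⟨fun y => (‖∇ g y‖)⁻¹ • ∇ g y, _, hN, ?_, hNx, fun v => ?_, fun p q hp hq => ?_⟩
  · filter_upwards [hg.eventually_of_mem_frontier (by norm_num) hV] with y hy
    exact hy.outwardNormal_eq (by norm_num)
  · have h1 : HasFDerivAt (fun y => ⟪(‖∇ g y‖)⁻¹ • ∇ g y, (‖∇ g y‖)⁻¹ • ∇ g y⟫_ℝ) _ x :=
      hN.inner ℝ hN
    have h2 : HasFDerivAt (fun y => ⟪(‖∇ g y‖)⁻¹ • ∇ g y, (‖∇ g y‖)⁻¹ • ∇ g y⟫_ℝ)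
        (0 : E3 →L[ℝ] ℝ) x := by
      refine (hasFDerivAt_const (1 : ℝ) x).congr_of_eventuallyEq ?_
      filter_upwards [hcont] with y hy
      rw [real_inner_self_eq_norm_sq, norm_smul]
      simp [hy]
    have h3 := congrArg (fun L : E3 →L[ℝ] ℝ => L v) (h1.unique h2)
    simp only [ContinuousLinearMap.comp_apply, ContinuousLinearMap.prod_apply, fderivInnerCLM_apply,
      zero_apply] at h3
    rw [hNx, real_inner_comm (outwardNormal V x)] at h3
    linarith
  · have hp' : ⟪p, ∇ g x⟫_ℝ = 0 := by
      rw [hg.gradient_eq_smul (by norm_num), inner_smul_right, real_inner_comm, hp, mul_zero]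
    have hq' : ⟪∇ g x, q⟫_ℝ = 0 := by
      rw [hg.gradient_eq_smul (by norm_num), real_inner_smul_left, hq, mul_zero]
    simp only [add_apply, smul_apply,
      ContinuousLinearMap.smulRight_apply, inner_add_left, inner_add_right, real_inner_smul_left,
      inner_smul_right, hp', hq', inner_fderiv_gradient_comm hg2 p q, hHdef, mul_zero]

lemma laplacian_eq_sum {f : E3 → ℝ} {x : E3} (hf : ContDiffAt ℝ 2 f x) :
    Laplacian.laplacian f x = ∑ i : Fin 3, ⟪labFrame i, fderiv ℝ (∇ f) x (labFrame i)⟫_ℝ := by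
  rw [InnerProductSpace.laplacian_eq_iteratedFDeriv_orthonormalBasis f
    (EuclideanSpace.basisFun (Fin 3) ℝ)]
  refine Finset.sum_congr rfl fun i _ => ?_
  rw [iteratedFDeriv_two_apply, real_inner_comm, (hasFDerivAt_gradient hf).2]
  simp [labFrame]

/-! ### The transferred condition in terms of ambient derivatives -/

section Pointwise

variable {V : Set E3} {x : E3} {g : E3 → ℝ} {φ : E3 → ℝ} {ρ : E3 → E3}

/-- The tangential trace is the full trace minus the normal-normal component. -/
lemma tangentialTrace_eq_sub (A : E3 →L[ℝ] E3) :
    tangentialTrace V x A = ∑ i : Fin 3, ⟪labFrame i, A (labFrame i)⟫_ℝ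
      - ⟪outwardNormal V x, A (outwardNormal V x)⟫_ℝ := by
  have h : tangentialTrace V x A = ∑ i : Fin 3, (⟪labFrame i, A (labFrame i)⟫_ℝ
      - ⟪labFrame i, outwardNormal V x⟫_ℝ * ⟪labFrame i, A (outwardNormal V x)⟫_ℝ) := by
    refine Finset.sum_congr rfl fun i _ => ?_
    rw [tangentialProj, map_sub, map_smul, inner_sub_right, inner_smul_right,
      real_inner_comm (labFrame i)]
  rw [h, Finset.sum_sub_distrib]
  congr 1
  conv_rhs => rw [← sum_inner_labFrame_smul (outwardNormal V x)]
  rw [sum_inner]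
  simp only [real_inner_smul_left, sum_inner_labFrame_smul]

/-- The field `ρ n·∇φ - ρ·n ∇φ` whose divergence enters the transferred condition. -/
noncomputable def transferField (V : Set E3) (ρ : E3 → E3) (φ : E3 → ℝ) (y : E3) : E3 :=
  ⟪outwardNormal V y, ∇ φ y⟫_ℝ • ρ y - ⟪ρ y, outwardNormal V y⟫_ℝ • ∇ φ y

/-- The field `ρ n·∇φ - ρ·n ∇φ` is tangential. -/
lemma tangentialProj_transferField (y : E3) :
    tangentialProj V y (transferField V ρ φ y) = transferField V ρ φ y := by
  apply tangentialProj_eq_self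
  rw [transferField, inner_sub_right, inner_smul_right, inner_smul_right,
    real_inner_comm (outwardNormal V y) (ρ y)]
  ring

/-- The terms in the derivative of the normal cancel, by the symmetry of the second fundamental
form. -/
lemma exists_extension_transferField (hg : IsLocalDefiningFunction 2 V x g) (hV : IsOpen V)
    (hφ : ContDiffAt ℝ 2 φ x) (hρ : DifferentiableAt ℝ ρ x) :
    ∃ w A, HasFDerivAt w A x ∧ transferField V ρ φ =ᶠ[𝓝[frontier V] x] w ∧
      tangentialTrace V x A =
        ⟪outwardNormal V x, fderiv ℝ (∇ φ) x (ρ x)⟫_ℝ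
        - ⟪outwardNormal V x, fderiv ℝ ρ x (∇ φ x)⟫_ℝ
        + ⟪outwardNormal V x, ∇ φ x⟫_ℝ * ⟪outwardNormal V x, fderiv ℝ ρ x (outwardNormal V x)⟫_ℝ
        + ⟪outwardNormal V x, ∇ φ x⟫_ℝ * tangentialTrace V x (fderiv ℝ ρ x)
        - Laplacian.laplacian φ x * ⟪ρ x, outwardNormal V x⟫_ℝ := by
  obtain ⟨N, M, hN⟩ := hg.exists_isNormalExtension hV
  have hn := hg.norm_outwardNormal (by norm_num)
  obtain ⟨hH, -⟩ := hasFDerivAt_gradient hφ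
  have h1 := (hN.hasFDerivAt.inner ℝ hH).smul hρ.hasFDerivAt
  have h2 := (hρ.hasFDerivAt.inner ℝ hN.hasFDerivAt).smul hH
  refine ⟨_, _, h1.sub h2, ?_, ?_⟩
  · filter_upwards [hN.eventuallyEq] with y hy
    simp only [transferField, hy, Pi.sub_apply, Pi.smul_apply']
  · simp only [tangentialTrace_sub, tangentialTrace_add, tangentialTrace_smul,
      tangentialTrace_smulRight, hN.apply_eq]
    rw [tangentialTrace_eq_sub (fderiv ℝ (∇ φ) x), ← laplacian_eq_sum hφ]
    simp only [ContinuousLinearMap.comp_apply, ContinuousLinearMap.prod_apply, fderivInnerCLM_apply]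
    have hdecomp : ∀ v, v = tangentialProj V x v + ⟪outwardNormal V x, v⟫_ℝ • outwardNormal V x := by
      intro v; simp [tangentialProj]
    set n := outwardNormal V x with hndef
    set r := ρ x with hr
    set G := ∇ φ x with hG
    set H := fderiv ℝ (∇ φ) x with hHd
    set R := fderiv ℝ ρ x with hRd
    have hPr := inner_outwardNormal_tangentialProj hn r
    have hPG := inner_outwardNormal_tangentialProj hn G
    have hM : ∀ v w, ⟪M v, w⟫_ℝ = ⟪M v, tangentialProj V x w⟫_ℝ := by
      intro v w
      conv_lhs => rw [hdecomp w]
      rw [inner_add_right, inner_smul_right, real_inner_comm, real_inner_comm n, hN.inner_eq_zero,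
        mul_zero, add_zero, real_inner_comm]
    have e1 : ⟪M (tangentialProj V x r), G⟫_ℝ = ⟪r, M (tangentialProj V x G)⟫_ℝ := by
      rw [hM, hN.symm _ _ hPr hPG, real_inner_comm, ← hM, real_inner_comm]
    have e2 : ⟪n, H (tangentialProj V x r)⟫_ℝ = ⟪n, H r⟫_ℝ - ⟪n, r⟫_ℝ * ⟪n, H n⟫_ℝ := by
      rw [tangentialProj, map_sub, map_smul, inner_sub_right, inner_smul_right]
    have e3 : ⟪R (tangentialProj V x G), n⟫_ℝ = ⟪n, R G⟫_ℝ - ⟪n, G⟫_ℝ * ⟪n, R n⟫_ℝ := by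
      rw [tangentialProj, map_sub, map_smul, real_inner_comm, inner_sub_right, inner_smul_right]
    rw [e1, e2, e3, real_inner_comm r n]
    ring

lemma transferredFlux_eq (hg : IsLocalDefiningFunction 2 V x g) (hV : IsOpen V)
    (hx : x ∈ frontier V) (hφ : ContDiffAt ℝ 2 φ x) (hρ : DifferentiableAt ℝ ρ x) (s : E3 → ℝ) :
    transferredFlux V ρ φ s x = ⟪outwardNormal V x, ∇ φ x⟫_ℝ
        + ⟪outwardNormal V x, fderiv ℝ (∇ φ) x (ρ x)⟫_ℝ
        - ⟪outwardNormal V x, fderiv ℝ ρ x (∇ φ x)⟫_ℝ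
        + ⟪outwardNormal V x, ∇ φ x⟫_ℝ * ⟪outwardNormal V x, fderiv ℝ ρ x (outwardNormal V x)⟫_ℝ
        + ⟪outwardNormal V x, ∇ φ x⟫_ℝ * tangentialTrace V x (fderiv ℝ ρ x)
        + (s x - Laplacian.laplacian φ x) * ⟪ρ x, outwardNormal V x⟫_ℝ := by
  obtain ⟨w, A, hA, hw, htr⟩ := exists_extension_transferField hg hV hφ hρ
  have h1 : extSurfDiv V (transferField V ρ φ) x = tangentialTrace V x A := by
    rw [extSurfDiv_eq_surfDiv]
    simp only [tangentialProj_transferField]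
    exact hg.surfDiv_eq (by norm_num) hV hx hA hw
  change _ + extSurfDiv V (transferField V ρ φ) x + _ = _
  rw [h1, htr]
  ring

/-- For a normal displacement the tangential part of `h ∇φ` is `-(ρ n·∇φ - ρ·n ∇φ)`. -/
lemma transferredFluxNormal_eq (hg : IsLocalDefiningFunction 2 V x g) (hV : IsOpen V)
    (hx : x ∈ frontier V) (hφ : ContDiffAt ℝ 2 φ x) (hρ : DifferentiableAt ℝ ρ x) (s : E3 → ℝ)
    {h : E3 → ℝ} (hh : ∀ y ∈ frontier V, ρ y = h y • outwardNormal V y) :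
    transferredFluxNormal V h φ s x = transferredFlux V ρ φ s x := by
  have hn := hg.norm_outwardNormal (by norm_num)
  obtain ⟨w, A, hA, hw, -⟩ := exists_extension_transferField hg hV hφ hρ
  have h1 : extSurfDiv V (transferField V ρ φ) x = tangentialTrace V x A := by
    rw [extSurfDiv_eq_surfDiv]
    simp only [tangentialProj_transferField]
    exact hg.surfDiv_eq (by norm_num) hV hx hA hw
  have h2 : extSurfDiv V (fun y => h y • ∇ φ y) x = -tangentialTrace V x A := by
    rw [extSurfDiv_eq_surfDiv, ← tangentialTrace_neg]
    refine hg.surfDiv_eq (by norm_num) hV hx hA.neg ?_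
    filter_upwards [hw, self_mem_nhdsWithin, hg.eventually_of_mem_frontier (by norm_num) hV]
      with y hy hyS hgy
    have hny := hgy.norm_outwardNormal (by norm_num)
    rw [Pi.neg_apply, ← hy, transferField, hh y hyS, tangentialProj, real_inner_smul_left,
      real_inner_self_eq_norm_sq, hny, inner_smul_right, smul_smul]
    simp [mul_comm]
  have h3 : ⟪ρ x, outwardNormal V x⟫_ℝ = h x := by
    rw [hh x hx, real_inner_smul_left, real_inner_self_eq_norm_sq, hn]; simp
  change _ - extSurfDiv V (fun y => h y • ∇ φ y) x + _
    = _ + extSurfDiv V (transferField V ρ φ) x + _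
  rw [h1, h2, h3]
  ring

lemma transferredData_eq (hg : IsLocalDefiningFunction 2 V x g) (hV : IsOpen V)
    (hx : x ∈ frontier V) {f : E3 → ℝ} (hf : DifferentiableAt ℝ f x)
    (hρ : DifferentiableAt ℝ ρ x) :
    transferredData V ρ f x =
      f x + fderiv ℝ f x (ρ x) + f x * tangentialTrace V x (fderiv ℝ ρ x) := by
  have h1 : surfDiv V (fun y => f y • ρ y) x = _ :=
    hg.surfDiv_eq (by norm_num) hV hx (hf.hasFDerivAt.smul hρ.hasFDerivAt) (EventuallyEq.refl _ _)
  rw [transferredData, h1, tangentialTrace_add, tangentialTrace_smul, tangentialTrace_smulRight,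
    tangentialProj, map_sub, map_smul, real_inner_comm (∇ f x), inner_gradient_left_E3,
    real_inner_comm (outwardNormal V x) (ρ x)]
  simp only [smul_eq_mul]
  ring

/-- The derivative of `f h` along the normal drops out of the surface divergence of `f h n`. -/
lemma transferredDataNormal_eq (hg : IsLocalDefiningFunction 2 V x g) (hV : IsOpen V)
    (hx : x ∈ frontier V) {f : E3 → ℝ} (hf : DifferentiableAt ℝ f x)
    (hρ : DifferentiableAt ℝ ρ x) {h : E3 → ℝ}
    (hh : ∀ y ∈ frontier V, ρ y = h y • outwardNormal V y) :
    transferredDataNormal V h f x = transferredData V ρ f x := by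
  have hn := hg.norm_outwardNormal (by norm_num)
  obtain ⟨N, M, hN⟩ := hg.exists_isNormalExtension hV
  have h3 : ⟪ρ x, outwardNormal V x⟫_ℝ = h x := by
    rw [hh x hx, real_inner_smul_left, real_inner_self_eq_norm_sq, hn]; simp
  have h1 : surfDiv V (outwardNormal V) x = tangentialTrace V x M :=
    hg.surfDiv_eq (by norm_num) hV hx hN.hasFDerivAt hN.eventuallyEq
  have h2 : surfDiv V (fun y => f y • ρ y) x = _ :=
    hg.surfDiv_eq (w' := fun y => (f y * ⟪ρ y, N y⟫_ℝ) • N y) (by norm_num) hV hx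
      ((hf.hasFDerivAt.mul (hρ.hasFDerivAt.inner ℝ hN.hasFDerivAt)).smul hN.hasFDerivAt) (by
      filter_upwards [hN.eventuallyEq, self_mem_nhdsWithin,
        hg.eventually_of_mem_frontier (by norm_num) hV] with y hy hyS hgy
      rw [← hy, hh y hyS, real_inner_smul_left, real_inner_self_eq_norm_sq,
        hgy.norm_outwardNormal (by norm_num), smul_smul]
      simp)
  have h4 : tangentialProj V x (outwardNormal V x) = 0 := by
    rw [tangentialProj, real_inner_self_eq_norm_sq, hn]; simp
  rw [transferredDataNormal, transferredData, h1, h2, tangentialTrace_add, tangentialTrace_smul,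
    tangentialTrace_smulRight, Pi.mul_apply, hN.apply_eq, h4, map_zero, h3]
  ring

end Pointwise

/-! ### The perturbed domain and its normal -/

section Perturbed

variable {ρ : E3 → E3} {q : ℝ}

lemma hasFDerivAt_displace {x : E3} (hρ : DifferentiableAt ℝ ρ x) :
    HasFDerivAt (displace ρ) (ContinuousLinearMap.id ℝ E3 + fderiv ℝ ρ x) x :=
  (hasFDerivAt_id x).add hρ.hasFDerivAt

/-- A displacement with derivative of norm at most `q < 1` is a `C^1` diffeomorphism. -/
lemma exists_homeomorph_displace (hρ : ContDiff ℝ 1 ρ) (hq : q < 1)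
    (hρq : ∀ x, ‖fderiv ℝ ρ x‖ ≤ q) :
    ∃ T : E3 ≃ₜ E3, ⇑T = displace ρ ∧ ContDiff ℝ 1 T.symm := by
  have hd : Differentiable ℝ ρ := hρ.differentiable (by simp)
  have hq0 : 0 ≤ q := (norm_nonneg _).trans (hρq 0)
  lift q to NNReal using hq0
  have happ : ApproximatesLinearOn (displace ρ)
      ((ContinuousLinearEquiv.refl ℝ E3 : E3 ≃L[ℝ] E3) : E3 →L[ℝ] E3) Set.univ q := by
    refine LipschitzOnWith.approximatesLinearOn ?_
    have : (displace ρ - ((ContinuousLinearEquiv.refl ℝ E3 : E3 ≃L[ℝ] E3) : E3 →L[ℝ] E3)) = ρ := by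
      funext y; simp [displace]
    rw [this]
    exact (lipschitzWith_of_nnnorm_fderiv_le hd fun x => hρq x).lipschitzOnWith
  have hc : Subsingleton E3 ∨ q < ‖((ContinuousLinearEquiv.refl ℝ E3).symm : E3 →L[ℝ] E3)‖₊⁻¹ := by
    right
    have : ‖((ContinuousLinearEquiv.refl ℝ E3).symm : E3 →L[ℝ] E3)‖₊ = 1 := by
      ext
      exact ContinuousLinearMap.norm_id
    rw [this, inv_one]
    exact_mod_cast hq
  refine ⟨happ.toHomeomorph _ hc, rfl, ?_⟩
  have hu : ∀ x, IsUnit (ContinuousLinearMap.id ℝ E3 + fderiv ℝ ρ x) := by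
    intro x
    have := isUnit_one_sub_of_norm_lt_one (x := -fderiv ℝ ρ x)
      (by rw [norm_neg]; exact (hρq x).trans_lt hq)
    rwa [sub_neg_eq_add] at this
  refine Homeomorph.contDiff_symm _
    (f₀' := fun x => ContinuousLinearEquiv.unitsEquiv ℝ E3 (hu x).unit) (fun x => ?_) ?_
  · exact hasFDerivAt_displace (hd x)
  · exact contDiff_id.add hρ

lemma frontier_perturbedDomain (hρ : ContDiff ℝ 1 ρ) (hq : q < 1)
    (hρq : ∀ x, ‖fderiv ℝ ρ x‖ ≤ q) (V : Set E3) :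
    frontier (perturbedDomain V ρ) = displace ρ '' frontier V := by
  obtain ⟨T, hT, -⟩ := exists_homeomorph_displace hρ hq hρq
  rw [perturbedDomain, ← hT, T.image_frontier]

/-- The normal of the perturbed domain is proportional to the image of the unperturbed normal under
the inverse transpose of the derivative of the displacement map. -/
lemma exists_inner_outwardNormal_perturbedDomain (hρ : ContDiff ℝ 1 ρ) (hq : q < 1)
    (hρq : ∀ x, ‖fderiv ℝ ρ x‖ ≤ q) {V : Set E3} {x : E3} {g : E3 → ℝ}
    (hg : IsLocalDefiningFunction 1 V x g) :
    ‖outwardNormal (perturbedDomain V ρ) (displace ρ x)‖ = 1 ∧ ∃ l : ℝ, 0 < l ∧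
      ∀ v, ⟪outwardNormal (perturbedDomain V ρ) (displace ρ x), v + fderiv ℝ ρ x v⟫_ℝ =
        l * ⟪outwardNormal V x, v⟫_ℝ := by
  obtain ⟨T, hT, hTs⟩ := exists_homeomorph_displace hρ hq hρq
  have hTx : T.symm (displace ρ x) = x := by rw [← hT, T.symm_apply_apply]
  have hc : ContDiffAt ℝ 1 (g ∘ T.symm) (displace ρ x) := by
    refine ContDiffAt.comp _ ?_ hTs.contDiffAt
    rw [hTx]; exact hg.contDiffAt
  have hGd : DifferentiableAt ℝ (g ∘ T.symm) (displace ρ x) := hc.differentiableAt (by simp)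
  have hchain : ∀ v, fderiv ℝ (g ∘ T.symm) (displace ρ x) (v + fderiv ℝ ρ x v)
      = fderiv ℝ g x v := by
    intro v
    have h1 := hGd.hasFDerivAt.comp x (hasFDerivAt_displace (hρ.differentiable (by simp) x))
    have h2 : (g ∘ T.symm) ∘ displace ρ = g := by
      funext y; simp [← hT]
    rw [h2] at h1
    rw [h1.fderiv]
    simp
  have hgrad : ∇ (g ∘ T.symm) (displace ρ x) ≠ 0 := by
    intro h0
    apply hg.gradient_ne_zero
    rw [← inner_self_eq_zero (𝕜 := ℝ), inner_gradient_left_E3, ← hchain, ← inner_gradient_left_E3,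
      h0, inner_zero_left]
  have hG : IsLocalDefiningFunction 1 (perturbedDomain V ρ) (displace ρ x) (g ∘ T.symm) := by
    refine ⟨hc, by simp [hTx, hg.eq_zero], hgrad, ?_⟩
    have h1 : Tendsto T.symm (𝓝 (displace ρ x)) (𝓝 x) := by
      simpa [hTx] using T.symm.continuous.tendsto (displace ρ x)
    filter_upwards [h1.eventually hg.mem_iff] with y hy
    rw [Function.comp_apply, ← hy, perturbedDomain, ← hT, T.image_eq_preimage_symm]
    rfl
  refine ⟨hG.norm_outwardNormal le_rfl, ‖∇ g x‖ / ‖∇ (g ∘ T.symm) (displace ρ x)‖,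
    div_pos (norm_pos_iff.2 hg.gradient_ne_zero) (norm_pos_iff.2 hgrad), fun v => ?_⟩
  rw [hG.outwardNormal_eq le_rfl, real_inner_smul_left, inner_gradient_left_E3, hchain,
    ← inner_gradient_left_E3]
  conv_lhs => rw [hg.gradient_eq_smul le_rfl, real_inner_smul_left]
  ring

/-- If `(1 + R)ᵀ ν = l n` for unit vectors `ν`, `n` and `l > 0`, then
`ν = n + (n·R n) n - Rᵀ n` up to an error of second order in `R`. -/
lemma abs_inner_sub_le {F : Type*} [NormedAddCommGroup F] [InnerProductSpace ℝ F]
    {ν n : F} {R : F →L[ℝ] F} {l : ℝ} (hν : ‖ν‖ = 1) (hn : ‖n‖ = 1)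
    (hl : 0 < l) (h : ∀ v, ⟪ν, v + R v⟫_ℝ = l * ⟪n, v⟫_ℝ) (v : F) :
    |⟪ν, v⟫_ℝ - (⟪n, v⟫_ℝ + ⟪n, R n⟫_ℝ * ⟪n, v⟫_ℝ - ⟪n, R v⟫_ℝ)| ≤ 6 * ‖R‖ ^ 2 * ‖v‖ := by
  have hR0 : 0 ≤ ‖R‖ := norm_nonneg R
  have hb : ∀ u v : F, |⟪u, R v⟫_ℝ| ≤ ‖u‖ * (‖R‖ * ‖v‖) := fun u v =>
    (abs_real_inner_le_norm _ _).trans (by gcongr; exact R.le_opNorm v)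
  have hl1 : l = ⟪ν, n⟫_ℝ + ⟪ν, R n⟫_ℝ := by
    have := h n
    rw [inner_add_right, real_inner_self_eq_norm_sq, hn] at this
    linarith
  have hl2 : 1 + ⟪ν, R ν⟫_ℝ = l * ⟪n, ν⟫_ℝ := by
    have := h ν
    rwa [inner_add_right, real_inner_self_eq_norm_sq, hν, one_pow] at this
  have hle : ⟪ν, n⟫_ℝ ≤ 1 := by simpa [hν, hn] using real_inner_le_norm ν n
  rw [real_inner_comm ν n] at hl2
  have a1 := abs_le.1 (hb ν n)
  have a2 := abs_le.1 (hb ν ν)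
  rw [hν, hn] at a1
  rw [hν] at a2
  have hup : l ≤ 1 + ‖R‖ := by linarith
  have hlow : 1 - ‖R‖ ≤ l := by nlinarith
  -- `ν - n` is of first order: `ν - n = (l - 1) n - Rᵀ ν`
  have hdiff : ‖ν - n‖ ≤ 2 * ‖R‖ := by
    have h1 : ‖ν - n‖ ^ 2 = (l - 1) * ⟪n, ν - n⟫_ℝ - ⟪ν, R (ν - n)⟫_ℝ := by
      have := h (ν - n)
      rw [inner_add_right] at this
      rw [← real_inner_self_eq_norm_sq, inner_sub_left]
      linarith
    have h2 := abs_le.1 (hb ν (ν - n))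
    have h3 := abs_le.1 (abs_real_inner_le_norm n (ν - n))
    rw [hν] at h2
    rw [hn] at h3
    have h4 : ‖ν - n‖ ^ 2 ≤ 2 * ‖R‖ * ‖ν - n‖ := by
      have h5 : (l - 1) * ⟪n, ν - n⟫_ℝ ≤ ‖R‖ * ‖ν - n‖ := by
        refine (le_abs_self _).trans ?_
        rw [abs_mul]
        exact mul_le_mul (abs_le.2 ⟨by linarith, by linarith⟩) (abs_le.2 ⟨by linarith, by linarith⟩)
          (abs_nonneg _) hR0
      linarith
    rcases (norm_nonneg (ν - n)).eq_or_lt with h0 | h0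
    · rw [← h0]; positivity
    · nlinarith
  have hsq : ‖ν - n‖ ^ 2 = 2 - 2 * ⟪ν, n⟫_ℝ := by
    rw [norm_sub_sq_real, hν, hn]; ring
  have hdn : |⟪ν - n, R n⟫_ℝ| ≤ 2 * ‖R‖ ^ 2 := by
    refine (hb _ _).trans ?_
    rw [hn]; nlinarith
  have hdv : |⟪ν - n, R v⟫_ℝ| ≤ 2 * ‖R‖ ^ 2 * ‖v‖ := by
    refine (hb _ _).trans ?_
    calc ‖ν - n‖ * (‖R‖ * ‖v‖) ≤ (2 * ‖R‖) * (‖R‖ * ‖v‖) := by gcongr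
      _ = _ := by ring
  have hl3 : |l - 1 - ⟪n, R n⟫_ℝ| ≤ 4 * ‖R‖ ^ 2 := by
    have e : l - 1 - ⟪n, R n⟫_ℝ = -(‖ν - n‖ ^ 2 / 2) + ⟪ν - n, R n⟫_ℝ := by
      rw [hsq, hl1, inner_sub_left]; ring
    have h6 : ‖ν - n‖ ^ 2 ≤ 4 * ‖R‖ ^ 2 := by nlinarith [norm_nonneg (ν - n)]
    have h7 := abs_le.1 hdn
    rw [e]
    exact abs_le.2 ⟨by nlinarith, by nlinarith [sq_nonneg ‖ν - n‖, sq_nonneg ‖R‖]⟩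
  have hfin : ⟪ν, v⟫_ℝ - (⟪n, v⟫_ℝ + ⟪n, R n⟫_ℝ * ⟪n, v⟫_ℝ - ⟪n, R v⟫_ℝ)
      = (l - 1 - ⟪n, R n⟫_ℝ) * ⟪n, v⟫_ℝ - ⟪ν - n, R v⟫_ℝ := by
    have := h v
    rw [inner_add_right] at this
    rw [inner_sub_left]
    linarith
  rw [hfin]
  have hnv : |⟪n, v⟫_ℝ| ≤ ‖v‖ := by simpa [hn] using abs_real_inner_le_norm n v
  calc _ ≤ |(l - 1 - ⟪n, R n⟫_ℝ) * ⟪n, v⟫_ℝ| + |⟪ν - n, R v⟫_ℝ| := abs_sub _ _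
    _ ≤ 4 * ‖R‖ ^ 2 * ‖v‖ + 2 * ‖R‖ ^ 2 * ‖v‖ := by
      rw [abs_mul]; gcongr
    _ = _ := by ring

end Perturbed

/-! ### Families of functions with equicontinuous derivatives -/

section Families

variable {Y : Type*} [NormedAddCommGroup Y] [NormedSpace ℝ Y] {ι : Type*} {l : Filter ι}

/-- The members of the family `F` are, along `l`, differentiable near `x₀`, and their derivatives
are equicontinuous at `x₀`. -/
structure IsEquiC1At (l : Filter ι) (F : ι → E3 → Y) (x₀ : E3) : Prop where
  differentiableAt : ∀ᶠ p : ι × E3 in l ×ˢ 𝓝 x₀, DifferentiableAt ℝ (F p.1) p.2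
  fderiv_sub_le : ∀ η > 0, ∀ᶠ p : ι × E3 in l ×ˢ 𝓝 x₀,
    ‖fderiv ℝ (F p.1) p.2 - fderiv ℝ (F p.1) x₀‖ ≤ η

lemma IsEquiC1At.add {F G : ι → E3 → Y} {x₀ : E3} (hF : IsEquiC1At l F x₀)
    (hG : IsEquiC1At l G x₀) : IsEquiC1At l (fun i y => F i y + G i y) x₀ := by
  refine ⟨?_, fun η hη => ?_⟩
  · filter_upwards [hF.1, hG.1] with p h1 h2 using h1.add h2
  · have h0 : ∀ {H : ι → E3 → Y}, IsEquiC1At l H x₀ →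
        ∀ᶠ p : ι × E3 in l ×ˢ 𝓝 x₀, DifferentiableAt ℝ (H p.1) x₀ := fun hH =>
      (hH.1.curry.mono fun i hi => hi.self_of_nhds).prod_inl _
    filter_upwards [hF.1, hG.1, hF.2 (η / 2) (by positivity), hG.2 (η / 2) (by positivity),
      h0 hF, h0 hG] with p h1 h2 h3 h4 h5 h6
    rw [fderiv_fun_add h1 h2, fderiv_fun_add h5 h6, add_sub_add_comm]
    exact (norm_add_le _ _).trans (by linarith)

lemma IsEquiC1At.const_mul {F : ι → E3 → ℝ} {x₀ : E3} (hF : IsEquiC1At l F x₀) (c : ℝ) :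
    IsEquiC1At l (fun i y => c * F i y) x₀ := by
  refine ⟨?_, fun η hη => ?_⟩
  · filter_upwards [hF.1] with p h1 using h1.const_mul c
  · have h0 : ∀ᶠ p : ι × E3 in l ×ˢ 𝓝 x₀, DifferentiableAt ℝ (F p.1) x₀ :=
      (hF.1.curry.mono fun i hi => hi.self_of_nhds).prod_inl _
    filter_upwards [hF.1, hF.2 (η / (|c| + 1)) (by positivity), h0] with p h1 h2 h3
    rw [fderiv_const_mul h1, fderiv_const_mul h3, ← smul_sub, norm_smul, Real.norm_eq_abs]
    rw [le_div_iff₀ (by positivity)] at h2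
    nlinarith [norm_nonneg (fderiv ℝ (F p.1) p.2 - fderiv ℝ (F p.1) x₀)]

lemma isEquiC1At_const {f : E3 → Y} {x₀ : E3} (hf : ContDiffAt ℝ 1 f x₀) :
    IsEquiC1At l (fun _ => f) x₀ := by
  refine ⟨?_, fun η hη => ?_⟩
  · exact ((hf.eventually (by simp)).mono fun y hy => hy.differentiableAt (by simp)).prod_inr _
  · have h1 : ContinuousAt (fderiv ℝ f) x₀ := (hf.fderiv_right (m := 0) (by norm_num)).continuousAt
    refine Eventually.prod_inr (p := fun y => ‖fderiv ℝ f y - fderiv ℝ f x₀‖ ≤ η) ?_ _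
    filter_upwards [Metric.continuousAt_iff'.1 h1 η hη] with y hy
    rw [← dist_eq_norm]; exact hy.le

/-- First order Taylor expansion, uniform along the family and in both points. -/
lemma IsEquiC1At.norm_sub_sub_le {F : ι → E3 → Y} {x₀ : E3} (hF : IsEquiC1At l F x₀)
    {η : ℝ} (hη : 0 < η) : ∀ᶠ p : ι × (E3 × E3) in l ×ˢ (𝓝 x₀ ×ˢ 𝓝 x₀),
      ‖F p.1 p.2.2 - F p.1 p.2.1 - fderiv ℝ (F p.1) p.2.1 (p.2.2 - p.2.1)‖
        ≤ η * ‖p.2.2 - p.2.1‖ := by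
  obtain ⟨pa, ha, pb, hb, hab⟩ :=
    eventually_prod_iff.1 (hF.1.and (hF.2 (η / 2) (by positivity)))
  obtain ⟨δ, hδ, hball⟩ := Metric.eventually_nhds_iff_ball.1 hb
  have hbn : ∀ᶠ y in 𝓝 x₀, y ∈ Metric.ball x₀ δ := Metric.ball_mem_nhds x₀ hδ
  filter_upwards [ha.prod_mk (hbn.prod_mk hbn)] with ⟨i, x, y⟩ ⟨hi, hx, hy⟩
  refine (convex_ball x₀ δ).norm_image_sub_le_of_norm_hasFDerivWithin_le'
    (f := F i) (f' := fderiv ℝ (F i))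
    (fun z hz => (hab hi (hball z hz)).1.hasFDerivAt.hasFDerivWithinAt)
    (fun z hz => ?_) hx hy
  have h1 := (hab hi (hball z hz)).2
  have h2 := (hab hi (hball x hx)).2
  calc _ = ‖(fderiv ℝ (F i) z - fderiv ℝ (F i) x₀) - (fderiv ℝ (F i) x - fderiv ℝ (F i) x₀)‖ := by
        congr 1; abel
    _ ≤ _ := norm_sub_le _ _
    _ ≤ η := by
        simp only at h1 h2; linarith

/-- First order Taylor expansion along a displacement. -/
lemma IsEquiC1At.isLittleO {F : ι → E3 → Y} {x₀ : E3} (hF : IsEquiC1At l F x₀)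
    {κ : Type*} {Λ : Filter κ} {i : κ → ι} {x y : κ → E3} (hi : Tendsto i Λ l)
    (hx : Tendsto x Λ (𝓝 x₀)) (hy : Tendsto y Λ (𝓝 x₀)) :
    (fun k => F (i k) (y k) - F (i k) (x k) - fderiv ℝ (F (i k)) (x k) (y k - x k))
      =o[Λ] fun k => y k - x k :=
  isLittleO_iff.2 fun _ hη =>
    (hi.prodMk (hx.prodMk hy)).eventually (hF.norm_sub_sub_le hη)

lemma norm_gradient_sub (f g : E3 → ℝ) (x y : E3) :
    ‖∇ f x - ∇ g y‖ = ‖fderiv ℝ f x - fderiv ℝ g y‖ := by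
  rw [← toDual_gradient, ← toDual_gradient, ← map_sub, LinearIsometryEquiv.norm_map]

lemma norm_gradient (f : E3 → ℝ) (x : E3) : ‖∇ f x‖ = ‖fderiv ℝ f x‖ := by
  rw [← toDual_gradient, LinearIsometryEquiv.norm_map]

lemma norm_le_of_inner_le {A : E3 →L[ℝ] E3} {C : ℝ} (hC : 0 ≤ C)
    (h : ∀ v w, |⟪A v, w⟫_ℝ| ≤ C * ‖v‖ * ‖w‖) : ‖A‖ ≤ C := by
  refine A.opNorm_le_bound hC fun v => ?_
  have h1 := h v (A v)
  rw [real_inner_self_eq_norm_sq, abs_of_nonneg (by positivity)] at h1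
  rcases (norm_nonneg (A v)).eq_or_lt with h0 | h0
  · rw [← h0]; positivity
  · nlinarith

lemma inner_fderiv_gradient_eq_iteratedFDeriv {f : E3 → ℝ} {x : E3} (hf : ContDiffAt ℝ 2 f x)
    (v w : E3) : ⟪fderiv ℝ (∇ f) x v, w⟫_ℝ = iteratedFDeriv ℝ 2 f x ![v, w] := by
  rw [(hasFDerivAt_gradient hf).2, iteratedFDeriv_two_apply]; simp

lemma norm_fderiv_gradient_le {f : E3 → ℝ} {x : E3} (hf : ContDiffAt ℝ 2 f x) :
    ‖fderiv ℝ (∇ f) x‖ ≤ ‖iteratedFDeriv ℝ 2 f x‖ := by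
  refine norm_le_of_inner_le (norm_nonneg _) fun v w => ?_
  rw [inner_fderiv_gradient_eq_iteratedFDeriv hf]
  refine ((iteratedFDeriv ℝ 2 f x).le_opNorm _).trans (le_of_eq ?_)
  simp [Fin.prod_univ_two, mul_assoc]

lemma norm_fderiv_gradient_sub_le {f : E3 → ℝ} {x y : E3} (hx : ContDiffAt ℝ 2 f x)
    (hy : ContDiffAt ℝ 2 f y) : ‖fderiv ℝ (∇ f) x - fderiv ℝ (∇ f) y‖ ≤
      ‖iteratedFDeriv ℝ 2 f x - iteratedFDeriv ℝ 2 f y‖ := by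
  refine norm_le_of_inner_le (norm_nonneg _) fun v w => ?_
  rw [sub_apply, inner_sub_left, inner_fderiv_gradient_eq_iteratedFDeriv hx,
    inner_fderiv_gradient_eq_iteratedFDeriv hy, ← sub_apply]
  refine ((iteratedFDeriv ℝ 2 f x - iteratedFDeriv ℝ 2 f y).le_opNorm _).trans (le_of_eq ?_)
  simp [Fin.prod_univ_two, mul_assoc]

lemma abs_laplacian_sub_le {f : E3 → ℝ} {x y : E3} (hx : ContDiffAt ℝ 2 f x)
    (hy : ContDiffAt ℝ 2 f y) : |Laplacian.laplacian f x - Laplacian.laplacian f y| ≤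
      3 * ‖fderiv ℝ (∇ f) x - fderiv ℝ (∇ f) y‖ := by
  have hi : ∀ i : Fin 3, ‖labFrame i‖ = 1 := fun i => by simp [labFrame]
  rw [laplacian_eq_sum hx, laplacian_eq_sum hy, ← Finset.sum_sub_distrib]
  simp only [← inner_sub_right]
  calc _ ≤ ∑ i : Fin 3, ‖fderiv ℝ (∇ f) x - fderiv ℝ (∇ f) y‖ := by
        refine (Finset.abs_sum_le_sum_abs _ _).trans (Finset.sum_le_sum fun i _ => ?_)
        refine (abs_real_inner_le_norm _ _).trans ?_
        rw [hi, one_mul]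
        refine ((fderiv ℝ (∇ f) x - fderiv ℝ (∇ f) y).le_opNorm _).trans (le_of_eq ?_)
        rw [hi, mul_one]
    _ = _ := by simp

end Families

/-! ### Equality to first order -/

section Compact

/-- A property that holds near each point of a compact set holds uniformly on it. -/
lemma eventually_prod_principal_of_forall {ι : Type*} {l : Filter ι} {S K : Set E3} (hKS : K ⊆ S)
    (hK : IsCompact K) {P : ι × E3 → Prop} (h : ∀ x ∈ K, ∀ᶠ p in l ×ˢ 𝓝[S] x, P p) :
    ∀ᶠ p in l ×ˢ 𝓟 K, P p := by
  have h1 : ∀ᶠ p in l ×ˢ 𝓝ˢ K, p.2 ∈ S → P p := by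
    refine hK.mem_prod_nhdsSet_of_forall fun x hx => ?_
    obtain ⟨pa, ha, pb, hb, hab⟩ := eventually_prod_iff.1 (h x hx)
    filter_upwards [ha.prod_mk (eventually_nhdsWithin_iff.1 hb)] with p hp hpS
    exact hab hp.1 (hp.2 hpS)
  have h2 : ∀ᶠ p in l ×ˢ 𝓟 K, p.2 ∈ K :=
    Eventually.prod_inr (eventually_principal.2 fun x hx => hx) _
  filter_upwards [h1.filter_mono (prod_mono le_rfl principal_le_nhdsSet), h2] with p hp hpK
  exact hp (hKS hpK)

lemma eqToFirstOrder_iff_isLittleO {K : Set E3} {A B : ℝ → E3 → ℝ} :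
    EqToFirstOrder K A B ↔
      (fun p : ℝ × E3 => A p.1 p.2 - B p.1 p.2) =o[𝓝[>] 0 ×ˢ 𝓟 K] fun p => p.1 := by
  rw [EqToFirstOrder, isLittleO_iff]
  refine forall₂_congr fun η hη => ?_
  rw [eventually_prod_principal_iff]
  refine eventually_congr ?_
  filter_upwards [self_mem_nhdsWithin] with ε (hε : 0 < ε)
  simp [Real.norm_eq_abs, abs_of_pos hε]

lemma EqToFirstOrder.congr' {K : Set E3} {A B A' B' : ℝ → E3 → ℝ} (h : EqToFirstOrder K A B)
    (hA : ∀ᶠ ε in 𝓝[>] (0 : ℝ), ∀ x ∈ K, A ε x = A' ε x)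
    (hB : ∀ᶠ ε in 𝓝[>] (0 : ℝ), ∀ x ∈ K, B ε x = B' ε x) : EqToFirstOrder K A' B' := by
  intro η hη
  filter_upwards [h η hη, hA, hB] with ε h1 h2 h3 x hx
  rw [← h2 x hx, ← h3 x hx]
  exact h1 x hx

/-- If `A' - B' = (1 + τ) (A - B) + o(ε)` with `τ = O(ε)`, then `A = B` to first order if and only
if `A' = B'` to first order. -/
lemma eqToFirstOrder_iff_of_isLittleO {K : Set E3} {A B A' B' τ : ℝ → E3 → ℝ}
    (hτ : (fun p : ℝ × E3 => τ p.1 p.2) =O[𝓝[>] 0 ×ˢ 𝓟 K] fun p => p.1)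
    (h : (fun p : ℝ × E3 => (A' p.1 p.2 - B' p.1 p.2)
      - (1 + τ p.1 p.2) * (A p.1 p.2 - B p.1 p.2)) =o[𝓝[>] 0 ×ˢ 𝓟 K] fun p => p.1) :
    EqToFirstOrder K A B ↔ EqToFirstOrder K A' B' := by
  rw [eqToFirstOrder_iff_isLittleO, eqToFirstOrder_iff_isLittleO]
  have h0 : Tendsto (fun p : ℝ × E3 => p.1) (𝓝[>] 0 ×ˢ 𝓟 K) (𝓝 0) :=
    (tendsto_fst (f := 𝓝[>] (0 : ℝ))).mono_right nhdsWithin_le_nhds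
  have hτ0 : Tendsto (fun p : ℝ × E3 => 1 + τ p.1 p.2) (𝓝[>] 0 ×ˢ 𝓟 K) (𝓝 1) := by
    simpa using (hτ.trans_tendsto h0).const_add 1
  constructor
  · intro hAB
    have h1 := (hτ0.isBigO_one ℝ).mul_isLittleO hAB
    simp only [one_mul] at h1
    exact (h.add h1).congr_left fun p => by ring
  · intro hAB
    have h1 := hAB.sub h
    have h2 : Tendsto (fun p : ℝ × E3 => (1 + τ p.1 p.2)⁻¹) (𝓝[>] 0 ×ˢ 𝓟 K) (𝓝 1⁻¹) :=
      hτ0.inv₀ one_ne_zero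
    have h3 := (h2.isBigO_one ℝ).mul_isLittleO h1
    simp only [one_mul] at h3
    refine h3.congr' ?_ EventuallyEq.rfl
    filter_upwards [hτ0.eventually_ne one_ne_zero] with p hp
    field_simp
    ring

end Compact

/-! ### First order expansion of the displaced condition -/

section Expansion

variable {F : Type*} [NormedAddCommGroup F] [InnerProductSpace ℝ F] {κ : Type*} {Λ : Filter κ}
  {ε : κ → ℝ}

lemma isBigO_clm_apply {F' : Type*} [NormedAddCommGroup F'] [NormedSpace ℝ F']
    {A : κ → F →L[ℝ] F'} {v : κ → F} {a b : κ → ℝ}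
    (hA : A =O[Λ] a) (hv : v =O[Λ] b) : (fun k => A k (v k)) =O[Λ] fun k => a k * b k := by
  refine (isBigO_of_le Λ fun k => ?_).trans (hA.norm_left.mul hv.norm_left)
  rw [norm_mul, norm_norm, norm_norm]
  exact (A k).le_opNorm (v k)

lemma isBigO_inner_of_norm_eq_one {n v : κ → F} (hn : ∀ᶠ k in Λ, ‖n k‖ = 1) :
    (fun k => ⟪n k, v k⟫_ℝ) =O[Λ] v := by
  refine IsBigO.of_bound 1 ?_
  filter_upwards [hn] with k hk
  simpa [hk] using abs_real_inner_le_norm (n k) (v k)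

lemma isLittleO_mul_self (hε : Tendsto ε Λ (𝓝 0)) : (fun k => ε k * ε k) =o[Λ] ε := by
  simpa using ((isLittleO_one_iff ℝ).2 hε).mul_isBigO (isBigO_refl ε Λ)

variable {n ν r G Q : κ → F} {R H : κ → F →L[ℝ] F}

/-- First order expansion of the normal derivative `ν·Q` at the displaced point, where `G` is the
gradient and `H` the Hessian at the original point, `Q` is the gradient at the displaced point, `r`
is the displacement with derivative `R`, and `n`, `ν` are the unperturbed and perturbed normals. -/
lemma isLittleO_normalDeriv (hε : Tendsto ε Λ (𝓝 0)) (hn : ∀ᶠ k in Λ, ‖n k‖ = 1)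
    (hν : ∀ᶠ k in Λ, |⟪ν k, Q k⟫_ℝ - (⟪n k, Q k⟫_ℝ + ⟪n k, R k (n k)⟫_ℝ * ⟪n k, Q k⟫_ℝ
      - ⟪n k, R k (Q k)⟫_ℝ)| ≤ 6 * ‖R k‖ ^ 2 * ‖Q k‖)
    (hr : r =O[Λ] ε) (hR : R =O[Λ] ε) (hG : G =O[Λ] fun _ => (1 : ℝ))
    (hH : H =O[Λ] fun _ => (1 : ℝ)) (hQ : (fun k => Q k - G k - H k (r k)) =o[Λ] ε) :
    (fun k => ⟪ν k, Q k⟫_ℝ - (⟪n k, G k⟫_ℝ + ⟪n k, H k (r k)⟫_ℝ - ⟪n k, R k (G k)⟫_ℝ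
        + ⟪n k, G k⟫_ℝ * ⟪n k, R k (n k)⟫_ℝ)) =o[Λ] ε ∧
      (fun k => ⟪ν k, Q k⟫_ℝ - ⟪n k, G k⟫_ℝ) =O[Λ] ε := by
  have hεε := isLittleO_mul_self hε
  have hn1 : n =O[Λ] fun _ => (1 : ℝ) := IsBigO.of_bound 1 (hn.mono fun k hk => by simp [hk])
  have hHr : (fun k => H k (r k)) =O[Λ] ε := by simpa using isBigO_clm_apply hH hr
  have hD : (fun k => Q k - G k) =O[Λ] ε :=
    (hQ.isBigO.add hHr).congr_left fun k => by abel
  have hε1 : ε =O[Λ] fun _ => (1 : ℝ) := hε.isBigO_one ℝ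
  have hQ1 : Q =O[Λ] fun _ => (1 : ℝ) :=
    ((hD.trans hε1).add hG).congr_left fun k => by abel
  have hRn : (fun k => ⟪n k, R k (n k)⟫_ℝ) =O[Λ] ε :=
    (isBigO_inner_of_norm_eq_one hn).trans (by simpa using isBigO_clm_apply hR hn1)
  have t1 : (fun k => ⟪n k, Q k - G k - H k (r k)⟫_ℝ) =o[Λ] ε :=
    (isBigO_inner_of_norm_eq_one hn).trans_isLittleO hQ
  have t2 : (fun k => ⟪n k, R k (n k)⟫_ℝ * ⟪n k, Q k - G k⟫_ℝ) =o[Λ] ε :=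
    (hRn.mul ((isBigO_inner_of_norm_eq_one hn).trans hD)).trans_isLittleO hεε
  have t3 : (fun k => ⟪n k, R k (Q k - G k)⟫_ℝ) =o[Λ] ε :=
    ((isBigO_inner_of_norm_eq_one hn).trans (isBigO_clm_apply hR hD)).trans_isLittleO hεε
  have t4 : (fun k => ⟪ν k, Q k⟫_ℝ - (⟪n k, Q k⟫_ℝ + ⟪n k, R k (n k)⟫_ℝ * ⟪n k, Q k⟫_ℝ
      - ⟪n k, R k (Q k)⟫_ℝ)) =o[Λ] ε := by
    have h1 : (fun k => ‖R k‖ * ‖R k‖ * ‖Q k‖) =o[Λ] ε := by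
      refine IsBigO.trans_isLittleO ?_ hεε
      simpa using (hR.norm_left.mul hR.norm_left).mul hQ1.norm_left
    refine IsBigO.trans_isLittleO (IsBigO.of_bound 6 ?_) h1
    filter_upwards [hν] with k hk
    rw [Real.norm_eq_abs, Real.norm_of_nonneg (by positivity : 0 ≤ ‖R k‖ * ‖R k‖ * ‖Q k‖)]
    exact hk.trans (le_of_eq (by ring))
  have hmain : (fun k => ⟪ν k, Q k⟫_ℝ - (⟪n k, G k⟫_ℝ + ⟪n k, H k (r k)⟫_ℝ - ⟪n k, R k (G k)⟫_ℝ
        + ⟪n k, G k⟫_ℝ * ⟪n k, R k (n k)⟫_ℝ)) =o[Λ] ε := by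
    refine (((t1.add t2).sub t3).add t4).congr_left fun k => ?_
    simp only [map_sub, inner_sub_right]
    ring
  refine ⟨hmain, ?_⟩
  have t5 : (fun k => ⟪n k, H k (r k)⟫_ℝ) =O[Λ] ε := (isBigO_inner_of_norm_eq_one hn).trans hHr
  have t6 : (fun k => ⟪n k, R k (G k)⟫_ℝ) =O[Λ] ε :=
    (isBigO_inner_of_norm_eq_one hn).trans (by simpa using isBigO_clm_apply hR hG)
  have t7 : (fun k => ⟪n k, G k⟫_ℝ * ⟪n k, R k (n k)⟫_ℝ) =O[Λ] ε := by
    simpa using ((isBigO_inner_of_norm_eq_one hn).trans hG).mul hRn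
  refine (((hmain.isBigO.add t5).sub t6).add t7).congr_left fun k => ?_
  ring

end Expansion

section Local

variable {ι : Type*} {l : Filter ι} {φ : ι → E3 → ℝ} {x₀ : E3}

lemma isEquiC1At_gradient (h2 : ∀ᶠ p : ι × E3 in l ×ˢ 𝓝 x₀, ContDiffAt ℝ 2 (φ p.1) p.2)
    (h : ∀ η > 0, ∀ᶠ p : ι × E3 in l ×ˢ 𝓝 x₀,
      ‖iteratedFDeriv ℝ 2 (φ p.1) p.2 - iteratedFDeriv ℝ 2 (φ p.1) x₀‖ ≤ η) :
    IsEquiC1At l (fun i => ∇ (φ i)) x₀ := by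
  refine ⟨h2.mono fun p hp => (hasFDerivAt_gradient hp).1.differentiableAt, fun η hη => ?_⟩
  have h0 : ∀ᶠ p : ι × E3 in l ×ˢ 𝓝 x₀, ContDiffAt ℝ 2 (φ p.1) x₀ :=
    (h2.curry.mono fun i hi => hi.self_of_nhds).prod_inl _
  filter_upwards [h2, h0, h η hη] with p h1 h2 h3
  exact (norm_fderiv_gradient_sub_le h1 h2).trans h3

/-- A bound on the second derivatives makes the first derivatives equicontinuous. -/
lemma isEquiC1At_of_gradient (h2 : ∀ᶠ p : ι × E3 in l ×ˢ 𝓝 x₀, ContDiffAt ℝ 2 (φ p.1) p.2)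
    (h : IsEquiC1At l (fun i => ∇ (φ i)) x₀) {C : ℝ}
    (hC : ∀ᶠ p : ι × E3 in l ×ˢ 𝓝 x₀, ‖iteratedFDeriv ℝ 2 (φ p.1) p.2‖ ≤ C) :
    IsEquiC1At l φ x₀ := by
  refine ⟨h2.mono fun p hp => hp.differentiableAt (by simp), fun η hη => ?_⟩
  have hx : Tendsto (fun p : ι × E3 => (p.1, (x₀, p.2))) (l ×ˢ 𝓝 x₀) (l ×ˢ (𝓝 x₀ ×ˢ 𝓝 x₀)) :=
    tendsto_fst.prodMk (tendsto_const_nhds.prodMk tendsto_snd)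
  have h0 : ∀ᶠ p : ι × E3 in l ×ˢ 𝓝 x₀, ‖fderiv ℝ (∇ (φ p.1)) x₀‖ ≤ C :=
    ((h2.and hC).curry.mono fun i hi =>
      (norm_fderiv_gradient_le hi.self_of_nhds.1).trans hi.self_of_nhds.2).prod_inl _
  have hnear : ∀ᶠ p : ι × E3 in l ×ˢ 𝓝 x₀, ‖p.2 - x₀‖ ≤ η / (1 + |C|) := by
    refine Eventually.prod_inr (p := fun y : E3 => ‖y - x₀‖ ≤ η / (1 + |C|)) ?_ _
    filter_upwards [Metric.closedBall_mem_nhds x₀ (show 0 < η / (1 + |C|) by positivity)] with y hy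
    rwa [mem_closedBall_iff_norm] at hy
  filter_upwards [hx.eventually (h.norm_sub_sub_le one_pos), h0, hnear] with p hp hp0 hpn
  rw [← norm_gradient_sub]
  have h3 := (fderiv ℝ (∇ (φ p.1)) x₀).le_opNorm (p.2 - x₀)
  have h4 : ‖fderiv ℝ (∇ (φ p.1)) x₀ (p.2 - x₀)‖ ≤ |C| * ‖p.2 - x₀‖ :=
    h3.trans (by gcongr; exact hp0.trans (le_abs_self C))
  have h5 : ‖∇ (φ p.1) p.2 - ∇ (φ p.1) x₀‖ ≤ (1 + |C|) * ‖p.2 - x₀‖ := by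
    have := norm_add_le (∇ (φ p.1) p.2 - ∇ (φ p.1) x₀ - fderiv ℝ (∇ (φ p.1)) x₀ (p.2 - x₀))
      (fderiv ℝ (∇ (φ p.1)) x₀ (p.2 - x₀))
    rw [sub_add_cancel] at this
    linarith
  refine h5.trans ?_
  rw [le_div_iff₀ (by positivity)] at hpn
  linarith

end Local

/-! ### Transfer of the condition near a boundary point -/

section Transfer

variable {V W : Set E3} {ρ : ℝ → E3 → E3} {φ : ℝ → E3 → ℝ} {C : ℝ} {x₀ : E3}

lemma tendsto_displace (hρ : ∀ᶠ ε in 𝓝[>] (0 : ℝ), ∀ x : E3, ‖ρ ε x‖ ≤ C * ε) (S : Set E3) :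
    Tendsto (fun p : ℝ × E3 => displace (ρ p.1) p.2) (𝓝[>] 0 ×ˢ 𝓝[S] x₀) (𝓝 x₀) := by
  have h1 : Tendsto (fun p : ℝ × E3 => ρ p.1 p.2) (𝓝[>] 0 ×ˢ 𝓝[S] x₀) (𝓝 0) := by
    have h2 : Tendsto (fun p : ℝ × E3 => C * p.1) (𝓝[>] 0 ×ˢ 𝓝[S] x₀) (𝓝 0) := by
      simpa using ((tendsto_fst (f := 𝓝[>] (0 : ℝ)) (g := 𝓝[S] x₀)).mono_right
        nhdsWithin_le_nhds).const_mul C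
    exact squeeze_zero_norm' ((hρ.prod_inl _).mono fun p hp => hp p.2) h2
  simpa [displace] using (tendsto_snd.mono_right nhdsWithin_le_nhds).add h1

/-- The Poisson equation holds on the unperturbed boundary up to `o(1)`: it extends by continuity to
the perturbed boundary, which is uniformly close. -/
lemma isLittleO_source_sub_laplacian {σ : E3 → ℝ → ℝ} (hW : IsOpen W) (hx₀ : x₀ ∈ W)
    (hσ : ContinuousOn (Function.uncurry σ) (W ×ˢ Set.univ))
    (hρ : ∀ᶠ ε in 𝓝[>] (0 : ℝ), ∀ x : E3, ‖ρ ε x‖ ≤ C * ε)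
    (hfr : ∀ᶠ ε in 𝓝[>] (0 : ℝ), ∀ x ∈ frontier V,
      displace (ρ ε) x ∈ closure (perturbedDomain V (ρ ε)))
    (hφ2 : ∀ᶠ p : ℝ × E3 in 𝓝[>] (0 : ℝ) ×ˢ 𝓝 x₀, ContDiffAt ℝ 2 (φ p.1) p.2)
    (hφgrad : IsEquiC1At (𝓝[>] (0 : ℝ)) (fun ε => ∇ (φ ε)) x₀)
    {B : ℝ} (hB : ∀ᶠ p : ℝ × E3 in 𝓝[>] (0 : ℝ) ×ˢ 𝓝 x₀, ‖φ p.1 p.2‖ ≤ B)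
    (hφT : Tendsto (fun p : ℝ × E3 => φ p.1 (displace (ρ p.1) p.2) - φ p.1 p.2)
      (𝓝[>] 0 ×ˢ 𝓝[frontier V] x₀) (𝓝 0))
    (hPoisson : ∀ᶠ ε in 𝓝[>] (0 : ℝ), ∀ y ∈ perturbedDomain V (ρ ε),
      Laplacian.laplacian (φ ε) y = σ y (φ ε y)) :
    (fun p : ℝ × E3 => σ p.2 (φ p.1 p.2) - Laplacian.laplacian (φ p.1) p.2)
      =o[𝓝[>] 0 ×ˢ 𝓝[frontier V] x₀] fun _ => (1 : ℝ) := by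
  set Λ := 𝓝[>] (0 : ℝ) ×ˢ 𝓝[frontier V] x₀ with hΛ
  have hΛle : Λ ≤ 𝓝[>] (0 : ℝ) ×ˢ 𝓝 x₀ := prod_mono le_rfl nhdsWithin_le_nhds
  have hT : Tendsto (fun p : ℝ × E3 => displace (ρ p.1) p.2) Λ (𝓝 x₀) := tendsto_displace hρ _
  have hTp : Tendsto (fun p : ℝ × E3 => (p.1, displace (ρ p.1) p.2)) Λ (𝓝[>] (0 : ℝ) ×ˢ 𝓝 x₀) :=
    tendsto_fst.prodMk hT
  have hS : ∀ᶠ p in Λ, p.2 ∈ frontier V :=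
    Eventually.prod_inr (p := fun x => x ∈ frontier V) self_mem_nhdsWithin _
  have hWn : ∀ᶠ y in 𝓝 x₀, y ∈ W := hW.mem_nhds hx₀
  -- the equation at the displaced points, by continuity up to the boundary
  have hA : ∀ᶠ p in Λ, Laplacian.laplacian (φ p.1) (displace (ρ p.1) p.2)
      = σ (displace (ρ p.1) p.2) (φ p.1 (displace (ρ p.1) p.2)) := by
    filter_upwards [hTp.eventually hφ2, hT.eventually hWn, hS, hfr.prod_inl _,
      hPoisson.prod_inl _] with p h1 h2 h3 h4 h5
    set z := displace (ρ p.1) p.2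
    have : (𝓝[perturbedDomain V (ρ p.1)] z).NeBot := mem_closure_iff_nhdsWithin_neBot.1 (h4 _ h3)
    have hzφ : ContDiffAt ℝ 2 (φ p.1) z := h1
    have c1 : ContinuousAt (Laplacian.laplacian (φ p.1)) z := by
      have e : (fun y => ∑ i : Fin 3, fderiv ℝ (fderiv ℝ (φ p.1)) y (labFrame i) (labFrame i))
          =ᶠ[𝓝 z] Laplacian.laplacian (φ p.1) := by
        filter_upwards [hzφ.eventually (by simp)] with y hy
        rw [laplacian_eq_sum hy]
        exact Finset.sum_congr rfl fun i _ => by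
          rw [real_inner_comm, (hasFDerivAt_gradient hy).2]
      refine ContinuousAt.congr ?_ e
      have h6 : ContinuousAt (fderiv ℝ (fderiv ℝ (φ p.1))) z :=
        ((hzφ.fderiv_right (m := 1) (by norm_num)).fderiv_right (m := 0)
          (by norm_num)).continuousAt
      exact tendsto_finsetSum _ fun i _ =>
        (h6.clm_apply continuousAt_const).clm_apply continuousAt_const
    have c2 : ContinuousAt (fun y => σ y (φ p.1 y)) z :=
      (hσ.continuousAt ((hW.prod isOpen_univ).mem_nhds ⟨h2, trivial⟩)).comp
        (f := fun y => (y, φ p.1 y)) (continuousAt_id.prodMk hzφ.continuousAt)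
    refine tendsto_nhds_unique (l := 𝓝[perturbedDomain V (ρ p.1)] z)
      (c1.tendsto.mono_left nhdsWithin_le_nhds)
      ((c2.tendsto.mono_left nhdsWithin_le_nhds).congr' ?_)
    filter_upwards [self_mem_nhdsWithin] with y hy using (h5 y hy).symm
  -- comparison of the Laplacians at the two points
  have hL : ∀ η > 0, ∀ᶠ p in Λ, |Laplacian.laplacian (φ p.1) (displace (ρ p.1) p.2)
      - Laplacian.laplacian (φ p.1) p.2| ≤ η := by
    intro η hη
    have hη6 : 0 < η / 6 := by positivity
    filter_upwards [hTp.eventually hφ2, hφ2.filter_mono hΛle,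
      hTp.eventually (hφgrad.fderiv_sub_le _ hη6), (hφgrad.fderiv_sub_le _ hη6).filter_mono hΛle]
      with p h1 h2 h3 h4
    refine (abs_laplacian_sub_le h1 h2).trans ?_
    have h5 := norm_sub_le
      (fderiv ℝ (∇ (φ p.1)) (displace (ρ p.1) p.2) - fderiv ℝ (∇ (φ p.1)) x₀)
      (fderiv ℝ (∇ (φ p.1)) p.2 - fderiv ℝ (∇ (φ p.1)) x₀)
    rw [sub_sub_sub_cancel_right] at h5
    linarith
  -- comparison of the sources at the two points
  have hσu : ∀ η > 0, ∀ᶠ p in Λ, |σ (displace (ρ p.1) p.2) (φ p.1 (displace (ρ p.1) p.2))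
      - σ p.2 (φ p.1 p.2)| ≤ η := by
    intro η hη
    obtain ⟨δ, hδ, hδW⟩ := Metric.nhds_basis_closedBall.mem_iff.1 (hW.mem_nhds hx₀)
    have hcpt : IsCompact (Metric.closedBall x₀ δ ×ˢ Metric.closedBall (0 : ℝ) B) :=
      (isCompact_closedBall _ _).prod (isCompact_closedBall _ _)
    have huc := hcpt.uniformContinuousOn_of_continuous
      (hσ.mono (Set.prod_mono hδW (Set.subset_univ _)))
    obtain ⟨θ, hθ, huc⟩ := Metric.uniformContinuousOn_iff.1 huc η hη
    have hball : ∀ᶠ y in 𝓝 x₀, y ∈ Metric.closedBall x₀ δ := Metric.closedBall_mem_nhds x₀ hδ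
    have hsnd : Tendsto (fun p : ℝ × E3 => p.2) Λ (𝓝 x₀) :=
      tendsto_snd.mono_right nhdsWithin_le_nhds
    have hdist : Tendsto (fun p : ℝ × E3 => dist (displace (ρ p.1) p.2) p.2) Λ (𝓝 0) := by
      simpa using hT.dist hsnd
    filter_upwards [hT.eventually hball, hsnd.eventually hball, hTp.eventually hB,
      hB.filter_mono hΛle, hdist.eventually (gt_mem_nhds hθ),
      (tendsto_zero_iff_norm_tendsto_zero.1 hφT).eventually (gt_mem_nhds hθ)]
      with p h1 h2 h3 h4 h5 h6
    have h7 := huc (displace (ρ p.1) p.2, φ p.1 (displace (ρ p.1) p.2))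
      ⟨h1, by simpa using h3⟩ (p.2, φ p.1 p.2) ⟨h2, by simpa using h4⟩
      (by rw [Prod.dist_eq]; exact max_lt h5 (by rw [dist_eq_norm]; exact h6))
    rw [Real.dist_eq] at h7
    exact h7.le
  refine isLittleO_iff.2 fun η hη => ?_
  filter_upwards [hA, hL (η / 2) (by positivity), hσu (η / 2) (by positivity)] with p h1 h2 h3
  rw [norm_one, mul_one, Real.norm_eq_abs]
  rw [h1] at h2
  rw [abs_le] at h2 h3 ⊢
  constructor <;> linarith

/-- The two conditions differ by `o(ε)`, up to the factor `1 + ∇_S·ρ`, near a boundary point. -/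
lemma isLittleO_transferred_sub_displaced (hV : IsOpen V) (hVb : HasC2Boundary V) (hW : IsOpen W)
    (hVW : frontier V ⊆ W) (hx₀ : x₀ ∈ frontier V)
    (hρ : ∀ᶠ ε in 𝓝[>] (0 : ℝ), ContDiff ℝ 1 (ρ ε))
    (hρC : ∀ᶠ ε in 𝓝[>] (0 : ℝ), ∀ x : E3, ‖ρ ε x‖ ≤ C * ε ∧ ‖fderiv ℝ (ρ ε) x‖ ≤ C * ε)
    {σ : E3 → ℝ → ℝ} (hσ : ContinuousOn (Function.uncurry σ) (W ×ˢ Set.univ))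
    (c : ℝ) {γ : E3 → ℝ} (hγ : ContDiffOn ℝ 1 γ W)
    (hφ : ∀ᶠ ε in 𝓝[>] (0 : ℝ), ContDiffOn ℝ 2 (φ ε) (W ∪ perturbedDomain V (ρ ε)))
    (hφ_ctrl : IsC2Controlled (frontier V) φ)
    (hPoisson : ∀ᶠ ε in 𝓝[>] (0 : ℝ), ∀ y ∈ perturbedDomain V (ρ ε),
      Laplacian.laplacian (φ ε) y = σ y (φ ε y)) :
    (fun p : ℝ × E3 =>
      (transferredFlux V (ρ p.1) (φ p.1) (fun y => σ y (φ p.1 y)) p.2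
        - transferredData V (ρ p.1) (fun y => c * φ p.1 y + γ y) p.2)
      - (1 + tangentialTrace V p.2 (fderiv ℝ (ρ p.1) p.2)) *
        (⟪outwardNormal (perturbedDomain V (ρ p.1)) (displace (ρ p.1) p.2),
            ∇ (φ p.1) (displace (ρ p.1) p.2)⟫_ℝ
          - (c * φ p.1 (displace (ρ p.1) p.2) + γ (displace (ρ p.1) p.2))))
      =o[𝓝[>] 0 ×ˢ 𝓝[frontier V] x₀] fun p => p.1 := by
  set Λ := 𝓝[>] (0 : ℝ) ×ˢ 𝓝[frontier V] x₀ with hΛ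
  have hΛle : Λ ≤ 𝓝[>] (0 : ℝ) ×ˢ 𝓝 x₀ := prod_mono le_rfl nhdsWithin_le_nhds
  have hε : Tendsto (fun p : ℝ × E3 => p.1) Λ (𝓝 0) := tendsto_fst.mono_right nhdsWithin_le_nhds
  have hεpos : ∀ᶠ p in Λ, 0 < p.1 :=
    Eventually.prod_inl (p := fun ε : ℝ => 0 < ε) self_mem_nhdsWithin _
  have hρ1 := hρC.mono fun ε h x => (h x).1
  have hT : Tendsto (fun p : ℝ × E3 => displace (ρ p.1) p.2) Λ (𝓝 x₀) := tendsto_displace hρ1 _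
  have hsnd : Tendsto (fun p : ℝ × E3 => p.2) Λ (𝓝 x₀) :=
    tendsto_snd.mono_right nhdsWithin_le_nhds
  have hS : ∀ᶠ p in Λ, p.2 ∈ frontier V :=
    Eventually.prod_inr (p := fun x => x ∈ frontier V) self_mem_nhdsWithin _
  have hWn : ∀ᶠ y in 𝓝 x₀, y ∈ W := hW.mem_nhds (hVW hx₀)
  have hCε : ∀ᶠ ε in 𝓝[>] (0 : ℝ), C * ε < 1 / 2 := by
    have : Tendsto (fun ε : ℝ => C * ε) (𝓝[>] 0) (𝓝 0) := by
      have h : Continuous fun ε : ℝ => C * ε := by fun_prop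
      exact (h.tendsto' 0 0 (by simp)).mono_left nhdsWithin_le_nhds
    exact this.eventually (gt_mem_nhds (by norm_num))
  have hφ2 : ∀ᶠ p : ℝ × E3 in 𝓝[>] (0 : ℝ) ×ˢ 𝓝 x₀, ContDiffAt ℝ 2 (φ p.1) p.2 := by
    filter_upwards [hφ.prod_mk hWn] with p hp
    exact hp.1.contDiffAt (mem_of_superset (hW.mem_nhds hp.2) Set.subset_union_left)
  obtain ⟨hbd, hequi⟩ := hφ_ctrl x₀ hx₀
  obtain ⟨B₀, hB₀⟩ := hbd 0 (by norm_num)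
  obtain ⟨B₁, hB₁⟩ := hbd 1 (by norm_num)
  obtain ⟨B₂, hB₂⟩ := hbd 2 le_rfl
  simp only [norm_iteratedFDeriv_zero] at hB₀
  simp only [norm_iteratedFDeriv_one] at hB₁
  have hEgrad : IsEquiC1At (𝓝[>] (0 : ℝ)) (fun ε => ∇ (φ ε)) x₀ := isEquiC1At_gradient hφ2 hequi
  have hEφ : IsEquiC1At (𝓝[>] (0 : ℝ)) φ x₀ := isEquiC1At_of_gradient hφ2 hEgrad hB₂
  have hγx : ContDiffAt ℝ 1 γ x₀ := hγ.contDiffAt hWn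
  have hEf : IsEquiC1At (𝓝[>] (0 : ℝ)) (fun ε y => c * φ ε y + γ y) x₀ :=
    (hEφ.const_mul c).add (isEquiC1At_const hγx)
  -- sizes of the quantities involved
  have hr : (fun p : ℝ × E3 => ρ p.1 p.2) =O[Λ] fun p => p.1 := by
    refine IsBigO.of_bound C ?_
    filter_upwards [hρ1.prod_inl _, hεpos] with p hp hp0
    rw [Real.norm_of_nonneg hp0.le]; exact hp p.2
  have hR : (fun p : ℝ × E3 => fderiv ℝ (ρ p.1) p.2) =O[Λ] fun p => p.1 := by
    refine IsBigO.of_bound C ?_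
    filter_upwards [hρC.prod_inl _, hεpos] with p hp hp0
    rw [Real.norm_of_nonneg hp0.le]; exact (hp p.2).2
  have hDφ : (fun p : ℝ × E3 => fderiv ℝ (φ p.1) p.2) =O[Λ] fun _ => (1 : ℝ) :=
    IsBigO.of_bound B₁ ((hB₁.filter_mono hΛle).mono fun p hp => by simpa using hp)
  have hG : (fun p : ℝ × E3 => ∇ (φ p.1) p.2) =O[Λ] fun _ => (1 : ℝ) :=
    IsBigO.of_bound B₁ ((hB₁.filter_mono hΛle).mono fun p hp => by simpa [norm_gradient] using hp)
  have hH : (fun p : ℝ × E3 => fderiv ℝ (∇ (φ p.1)) p.2) =O[Λ] fun _ => (1 : ℝ) := by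
    refine IsBigO.of_bound B₂ ?_
    filter_upwards [hB₂.filter_mono hΛle, hφ2.filter_mono hΛle] with p hp hp2
    simpa using (norm_fderiv_gradient_le hp2).trans hp
  have hdis : ∀ p : ℝ × E3, displace (ρ p.1) p.2 - p.2 = ρ p.1 p.2 := fun p => by simp [displace]
  have hfst : Tendsto (fun p : ℝ × E3 => p.1) Λ (𝓝[>] (0 : ℝ)) := tendsto_fst
  -- Taylor expansions at the displaced point
  have hQ : (fun p : ℝ × E3 => ∇ (φ p.1) (displace (ρ p.1) p.2) - ∇ (φ p.1) p.2
      - fderiv ℝ (∇ (φ p.1)) p.2 (ρ p.1 p.2)) =o[Λ] fun p => p.1 := by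
    have := hEgrad.isLittleO hfst hsnd hT
    simp only [hdis] at this
    exact this.trans_isBigO hr
  have hf : (fun p : ℝ × E3 => (c * φ p.1 (displace (ρ p.1) p.2) + γ (displace (ρ p.1) p.2))
      - (c * φ p.1 p.2 + γ p.2)
      - fderiv ℝ (fun y => c * φ p.1 y + γ y) p.2 (ρ p.1 p.2)) =o[Λ] fun p => p.1 := by
    have := hEf.isLittleO hfst hsnd hT
    simp only [hdis] at this
    exact this.trans_isBigO hr
  have hφT : Tendsto (fun p : ℝ × E3 => φ p.1 (displace (ρ p.1) p.2) - φ p.1 p.2) Λ (𝓝 0) := by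
    have h1 := hEφ.isLittleO hfst hsnd hT
    simp only [hdis] at h1
    have h2 := (h1.trans_isBigO hr).isBigO.add
      ((isBigO_clm_apply hDφ hr).congr_right fun p => one_mul _)
    simp only [sub_add_cancel] at h2
    exact h2.trans_tendsto hε
  have hDf : (fun p : ℝ × E3 => fderiv ℝ (fun y => c * φ p.1 y + γ y) p.2)
      =O[Λ] fun _ => (1 : ℝ) := by
    have h1 : (fun p : ℝ × E3 => fderiv ℝ γ p.2) =O[Λ] fun _ => (1 : ℝ) :=
      (((hγx.fderiv_right (m := 0) (by norm_num)).continuousAt.tendsto.comp hsnd).isBigO_one ℝ)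
    refine ((hDφ.const_smul_left c).add h1).congr' ?_ EventuallyEq.rfl
    filter_upwards [hφ2.filter_mono hΛle, hsnd.eventually (hγx.eventually (by simp))] with p h2 h3
    have h4 := h2.differentiableAt (by simp)
    rw [fderiv_fun_add (h4.const_mul c) (h3.differentiableAt (by simp)), fderiv_const_mul h4]
    rfl
  -- geometry at the nearby boundary points
  have hn : ∀ᶠ p in Λ, ‖outwardNormal V p.2‖ = 1 := hS.mono fun p hp => by
    obtain ⟨g, hg⟩ := hVb p.2 hp
    exact hg.norm_outwardNormal (by norm_num)
  have hν : ∀ᶠ p in Λ, |⟪outwardNormal (perturbedDomain V (ρ p.1)) (displace (ρ p.1) p.2),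
        ∇ (φ p.1) (displace (ρ p.1) p.2)⟫_ℝ
      - (⟪outwardNormal V p.2, ∇ (φ p.1) (displace (ρ p.1) p.2)⟫_ℝ
        + ⟪outwardNormal V p.2, fderiv ℝ (ρ p.1) p.2 (outwardNormal V p.2)⟫_ℝ *
          ⟪outwardNormal V p.2, ∇ (φ p.1) (displace (ρ p.1) p.2)⟫_ℝ
        - ⟪outwardNormal V p.2, fderiv ℝ (ρ p.1) p.2 (∇ (φ p.1) (displace (ρ p.1) p.2))⟫_ℝ)|
      ≤ 6 * ‖fderiv ℝ (ρ p.1) p.2‖ ^ 2 * ‖∇ (φ p.1) (displace (ρ p.1) p.2)‖ := by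
    filter_upwards [hS, hn, hρ.prod_inl _, hρC.prod_inl _, hCε.prod_inl _] with p h1 h2 h3 h4 h5
    obtain ⟨g, hg⟩ := hVb p.2 h1
    obtain ⟨h6, s, hs, h7⟩ := exists_inner_outwardNormal_perturbedDomain h3 (q := 1 / 2)
      (by norm_num) (fun x => (h4 x).2.trans h5.le) (hg.of_le (by norm_num))
    exact abs_inner_sub_le h6 h2 hs h7 _
  obtain ⟨hLd, hLd'⟩ := isLittleO_normalDeriv hε hn hν hr hR hG hH hQ
  have hfr : ∀ᶠ ε in 𝓝[>] (0 : ℝ), ∀ x ∈ frontier V,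
      displace (ρ ε) x ∈ closure (perturbedDomain V (ρ ε)) := by
    filter_upwards [hρ, hρC, hCε] with ε h3 h4 h5 x hx
    apply frontier_subset_closure
    rw [frontier_perturbedDomain h3 (q := 1 / 2) (by norm_num) (fun x => (h4 x).2.trans h5.le)]
    exact Set.mem_image_of_mem _ hx
  have hω := isLittleO_source_sub_laplacian hW (hVW hx₀) hσ hρ1 hfr hφ2 hEgrad hB₀ hφT hPoisson
  have hτ : (fun p : ℝ × E3 => tangentialTrace V p.2 (fderiv ℝ (ρ p.1) p.2))
      =O[Λ] fun p => p.1 := by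
    refine IsBigO.trans (IsBigO.of_bound 6 ?_) hR
    filter_upwards [hn] with p hp
    exact abs_tangentialTrace_le hp _
  have hrn : (fun p : ℝ × E3 => ⟪ρ p.1 p.2, outwardNormal V p.2⟫_ℝ) =O[Λ] fun p => p.1 :=
    ((isBigO_inner_of_norm_eq_one hn).congr_left fun p => real_inner_comm _ _).trans hr
  have hDfr : (fun p : ℝ × E3 => fderiv ℝ (fun y => c * φ p.1 y + γ y) p.2 (ρ p.1 p.2))
      =O[Λ] fun p => p.1 := (isBigO_clm_apply hDf hr).congr_right fun p => one_mul _
  have hfb := hf.isBigO.add hDfr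
  -- the two products are of second order, and the last one is `o(1) O(ε)`
  have hp1 := (hτ.mul (hfb.sub hLd')).trans_isLittleO (isLittleO_mul_self hε)
  have hp2 := (hω.mul_isBigO hrn).congr_right fun p => one_mul _
  refine (((hf.sub hLd).add hp1).add hp2).congr' ?_ EventuallyEq.rfl
  filter_upwards [hS, hφ2.filter_mono hΛle, hρ.prod_inl _, hEf.differentiableAt.filter_mono hΛle]
    with p h1 h2 h3 h4
  obtain ⟨g, hg⟩ := hVb p.2 h1
  have h5 := h3.differentiable (by simp) p.2
  rw [transferredFlux_eq hg hV h1 h2 h5, transferredData_eq hg hV h1 h4 h5]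
  ring

end Transfer

/-! ### Uniformity on compact parts of the boundary -/

theorem mainTheorem3
    -- the unperturbed domain and a neighbourhood of its boundary
    (V₀ W : Set E3) (hV₀ : IsOpen V₀) (hV₀_bdry : HasC2Boundary V₀)
    (hW : IsOpen W) (hVW : frontier V₀ ⊆ W)
    -- the displacement, of size `O(ε)` in `C^1`
    (ρ : ℝ → E3 → E3) (hρ : ∀ᶠ ε in 𝓝[>] (0 : ℝ), ContDiff ℝ 1 (ρ ε))
    (hρ_small : ∃ C : ℝ, ∀ᶠ ε in 𝓝[>] (0 : ℝ), ∀ x : E3,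
      ‖ρ ε x‖ ≤ C * ε ∧ ‖fderiv ℝ (ρ ε) x‖ ≤ C * ε)
    -- the data of the Poisson problem
    (σ : E3 → ℝ → ℝ) (hσ : ContinuousOn (Function.uncurry σ) (W ×ˢ Set.univ))
    (c : ℝ) (γ : E3 → ℝ) (hγ : ContDiffOn ℝ 1 γ W)
    -- the solutions of the Poisson equation on the perturbed domains
    (φ : ℝ → E3 → ℝ)
    (hφ : ∀ᶠ ε in 𝓝[>] (0 : ℝ), ContDiffOn ℝ 2 (φ ε) (W ∪ perturbedDomain V₀ (ρ ε)))
    (hφ_ctrl : IsC2Controlled (frontier V₀) φ)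
    (hPoisson : ∀ᶠ ε in 𝓝[>] (0 : ℝ), ∀ y ∈ perturbedDomain V₀ (ρ ε),
      Laplacian.laplacian (φ ε) y = σ y (φ ε y)) :
    -- transfer of the exact Robin condition from the perturbed to the unperturbed boundary
    ((∀ᶠ ε in 𝓝[>] (0 : ℝ), ∀ y ∈ frontier (perturbedDomain V₀ (ρ ε)),
        ⟪outwardNormal (perturbedDomain V₀ (ρ ε)) y, ∇ (φ ε) y⟫_ℝ = c * φ ε y + γ y) →
      ∀ K ⊆ frontier V₀, IsCompact K →
        EqToFirstOrder K
          (fun ε => transferredFlux V₀ (ρ ε) (φ ε) (fun y => σ y (φ ε y)))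
          (fun ε => transferredData V₀ (ρ ε) (fun y => c * φ ε y + γ y))) ∧
    -- to first order, the two conditions are equivalent
    (∀ K ⊆ frontier V₀, IsCompact K →
      (EqToFirstOrder K
          (fun ε x => ⟪outwardNormal (perturbedDomain V₀ (ρ ε)) (displace (ρ ε) x),
            ∇ (φ ε) (displace (ρ ε) x)⟫_ℝ)
          (fun ε x => c * φ ε (displace (ρ ε) x) + γ (displace (ρ ε) x)) ↔
        EqToFirstOrder K
          (fun ε => transferredFlux V₀ (ρ ε) (φ ε) (fun y => σ y (φ ε y)))
          (fun ε => transferredData V₀ (ρ ε) (fun y => c * φ ε y + γ y)))) ∧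
    -- the same for a displacement `ρ = h n` in the normal direction
    (∀ h : ℝ → E3 → ℝ,
      (∀ᶠ ε in 𝓝[>] (0 : ℝ), ∀ x ∈ frontier V₀, ρ ε x = h ε x • outwardNormal V₀ x) →
      ((∀ᶠ ε in 𝓝[>] (0 : ℝ), ∀ y ∈ frontier (perturbedDomain V₀ (ρ ε)),
          ⟪outwardNormal (perturbedDomain V₀ (ρ ε)) y, ∇ (φ ε) y⟫_ℝ = c * φ ε y + γ y) →
        ∀ K ⊆ frontier V₀, IsCompact K →
          EqToFirstOrder K
            (fun ε => transferredFluxNormal V₀ (h ε) (φ ε) (fun y => σ y (φ ε y)))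
            (fun ε => transferredDataNormal V₀ (h ε) (fun y => c * φ ε y + γ y))) ∧
      (∀ K ⊆ frontier V₀, IsCompact K →
        (EqToFirstOrder K
            (fun ε x => ⟪outwardNormal (perturbedDomain V₀ (ρ ε)) (displace (ρ ε) x),
              ∇ (φ ε) (displace (ρ ε) x)⟫_ℝ)
            (fun ε x => c * φ ε (displace (ρ ε) x) + γ (displace (ρ ε) x)) ↔
          EqToFirstOrder K
            (fun ε => transferredFluxNormal V₀ (h ε) (φ ε) (fun y => σ y (φ ε y)))
            (fun ε => transferredDataNormal V₀ (h ε) (fun y => c * φ ε y + γ y))))) := by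
  obtain ⟨C, hC⟩ := hρ_small
  have hCε : ∀ᶠ ε in 𝓝[>] (0 : ℝ), C * ε < 1 / 2 := by
    have h : Continuous fun ε : ℝ => C * ε := by fun_prop
    exact ((h.tendsto' 0 0 (by simp)).mono_left nhdsWithin_le_nhds).eventually
      (gt_mem_nhds (by norm_num))
  have hequiv : ∀ K ⊆ frontier V₀, IsCompact K →
      (EqToFirstOrder K
          (fun ε x => ⟪outwardNormal (perturbedDomain V₀ (ρ ε)) (displace (ρ ε) x),
            ∇ (φ ε) (displace (ρ ε) x)⟫_ℝ)
          (fun ε x => c * φ ε (displace (ρ ε) x) + γ (displace (ρ ε) x)) ↔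
        EqToFirstOrder K
          (fun ε => transferredFlux V₀ (ρ ε) (φ ε) (fun y => σ y (φ ε y)))
          (fun ε => transferredData V₀ (ρ ε) (fun y => c * φ ε y + γ y))) := by
    intro K hK hKc
    refine eqToFirstOrder_iff_of_isLittleO
      (τ := fun ε x => tangentialTrace V₀ x (fderiv ℝ (ρ ε) x)) ?_ ?_
    · refine IsBigO.of_bound (6 * C) ?_
      rw [eventually_prod_principal_iff]
      filter_upwards [hC, self_mem_nhdsWithin] with ε h1 (h2 : 0 < ε) x hx
      obtain ⟨g, hg⟩ := hV₀_bdry x (hK hx)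
      have h3 := abs_tangentialTrace_le (hg.norm_outwardNormal (by norm_num)) (fderiv ℝ (ρ ε) x)
      rw [Real.norm_eq_abs, Real.norm_of_nonneg h2.le]
      linarith [(h1 x).2]
    · exact isLittleO_iff.2 fun η hη => eventually_prod_principal_of_forall hK hKc fun x hx =>
        isLittleO_iff.1 (isLittleO_transferred_sub_displaced hV₀ hV₀_bdry hW hVW (hK hx) hρ hC hσ c
          hγ hφ hφ_ctrl hPoisson) hη
  -- the perturbed boundary is the image of `frontier V₀`, so the exact condition can be displaced
  have hexact : (∀ᶠ ε in 𝓝[>] (0 : ℝ), ∀ y ∈ frontier (perturbedDomain V₀ (ρ ε)),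
        ⟪outwardNormal (perturbedDomain V₀ (ρ ε)) y, ∇ (φ ε) y⟫_ℝ = c * φ ε y + γ y) →
      ∀ K ⊆ frontier V₀, EqToFirstOrder K
          (fun ε x => ⟪outwardNormal (perturbedDomain V₀ (ρ ε)) (displace (ρ ε) x),
            ∇ (φ ε) (displace (ρ ε) x)⟫_ℝ)
          (fun ε x => c * φ ε (displace (ρ ε) x) + γ (displace (ρ ε) x)) := by
    intro hR K hK η hη
    filter_upwards [hR, hρ, hC, hCε, self_mem_nhdsWithin] with ε h1 h2 h3 h4 (h5 : 0 < ε) x hx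
    have h6 : displace (ρ ε) x ∈ frontier (perturbedDomain V₀ (ρ ε)) := by
      rw [frontier_perturbedDomain h2 (q := 1 / 2) (by norm_num) fun x => (h3 x).2.trans h4.le]
      exact Set.mem_image_of_mem _ (hK hx)
    rw [h1 _ h6, sub_self, abs_zero]
    positivity
  have hnormal : ∀ h : ℝ → E3 → ℝ,
      (∀ᶠ ε in 𝓝[>] (0 : ℝ), ∀ x ∈ frontier V₀, ρ ε x = h ε x • outwardNormal V₀ x) →
      ∀ K ⊆ frontier V₀,
        (EqToFirstOrder K
          (fun ε => transferredFlux V₀ (ρ ε) (φ ε) (fun y => σ y (φ ε y)))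
          (fun ε => transferredData V₀ (ρ ε) (fun y => c * φ ε y + γ y)) ↔
        EqToFirstOrder K
          (fun ε => transferredFluxNormal V₀ (h ε) (φ ε) (fun y => σ y (φ ε y)))
          (fun ε => transferredDataNormal V₀ (h ε) (fun y => c * φ ε y + γ y))) := by
    intro h hh K hK
    have hφ2 : ∀ᶠ ε in 𝓝[>] (0 : ℝ), ∀ x ∈ frontier V₀, ContDiffAt ℝ 2 (φ ε) x := by
      filter_upwards [hφ] with ε h1 x hx
      exact h1.contDiffAt (mem_of_superset (hW.mem_nhds (hVW hx)) Set.subset_union_left)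
    have hA : ∀ᶠ ε in 𝓝[>] (0 : ℝ), ∀ x ∈ K,
        transferredFluxNormal V₀ (h ε) (φ ε) (fun y => σ y (φ ε y)) x
          = transferredFlux V₀ (ρ ε) (φ ε) (fun y => σ y (φ ε y)) x := by
      filter_upwards [hh, hφ2, hρ] with ε h1 h2 h3 x hx
      obtain ⟨g, hg⟩ := hV₀_bdry x (hK hx)
      exact transferredFluxNormal_eq hg hV₀ (hK hx) (h2 x (hK hx))
        (h3.differentiable (by simp) x) _ h1
    have hB : ∀ᶠ ε in 𝓝[>] (0 : ℝ), ∀ x ∈ K,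
        transferredDataNormal V₀ (h ε) (fun y => c * φ ε y + γ y) x
          = transferredData V₀ (ρ ε) (fun y => c * φ ε y + γ y) x := by
      filter_upwards [hh, hφ2, hρ] with ε h1 h2 h3 x hx
      obtain ⟨g, hg⟩ := hV₀_bdry x (hK hx)
      have hγx : ContDiffAt ℝ 1 γ x := hγ.contDiffAt (hW.mem_nhds (hVW (hK hx)))
      exact transferredDataNormal_eq hg hV₀ (hK hx)
        ((((h2 x (hK hx)).differentiableAt (by simp)).const_mul c).add
          (hγx.differentiableAt (by simp)))
        (h3.differentiable (by simp) x) h1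
    exact ⟨fun H => H.congr' (hA.mono fun ε h1 x hx => (h1 x hx).symm)
      (hB.mono fun ε h1 x hx => (h1 x hx).symm), fun H => H.congr' hA hB⟩
  exact ⟨fun hR K hK hKc => (hequiv K hK hKc).1 (hexact hR K hK), hequiv, fun h hh =>
    ⟨fun hR K hK hKc => (hnormal h hh K hK).1 ((hequiv K hK hKc).1 (hexact hR K hK)),
      fun K hK hKc => (hequiv K hK hKc).trans (hnormal h hh K hK)⟩⟩
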